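/- For every $\beta>0$ and $\delta>0$ there exists $C>0$, depending only on $\beta$ and $\delta$, such that the following holds for every integer $n\ge 2$. Let $A=\{u_1,v_1\}\times\cdots\times\{u_n,v_n\}\subset\mathbb{Z}^n$ be a two-cube, where $u_j\neq v_j$ are integers for each $j$, with differences $d_j=u_j-v_j$. Let $B\subseteq\{\pm1\}^n$ be of size $|B|=2^{\beta n}$, let $Y$ be uniformly distributed in $B$, and write $\langle x,Y\rangle=\sum_{j=1}^n x_jY_j$. (1) For all but at most $2^{n(1-\beta+\delta)}$ directions $x\in A$, $$\max_{k\in\mathbb{Z}}\Pr_Y[\langle x,Y\rangle=k]\le C\sqrt{\frac{\ln n}{n}}.$$ (2) If $d_1,\ldots,d_n$ are distinct, then for all but at most $2^{n(1-\beta+\delta)}$ directions $x\in A$, $$\max_{k\in\mathbb{Z}}\Pr_Y[\langle x,Y\rangle=k]\le C\sqrt{\frac{\ln n}{n^3}}.$$ (3) If $\{d_1,\ldots,d_n\}$ is a weak Sidon set of size $n$, then for all but at most $2^{n(1-\beta+\delta)}$ directions $x\in A$, $$\max_{k\in\mathbb{Z}}\Pr_Y[\langle x,Y\rangle=k]\le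 C\sqrt{\frac{\ln n}{n^5}}.$$ Here a finite set $S\subset\mathbb{Z}$ is called a weak Sidon set if the number of solutions of $\epsilon_1s_1+\epsilon_2s_2=\epsilon_3s_3+\epsilon_4s_4$ with $\epsilon_1,\ldots,\epsilon_4\in\{\pm1\}$ and $s_1,\ldots,s_4\in S$ is at most $100\,|S|^2$. -/

import Mathlib

namespace TwoCube

/-- The cube `{±1}^n`, as a finite set of integer vectors. -/
def signCube (n : ℕ) : Finset (Fin n → ℤ) :=
  Fintype.piFinset fun _ => {1, -1}

/-- The product `{u_1, v_1} × ⋯ × {u_n, v_n} ⊆ ℤ^n`. It is a two-cube when `u j ≠ v j` for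
every `j`; its differences are then the integers `u j - v j`. -/
def twoCube {n : ℕ} (u v : Fin n → ℤ) : Finset (Fin n → ℤ) :=
  Fintype.piFinset fun j => {u j, v j}

/-- The probability that `⟨x, Y⟩ = ∑ j, x j * Y j` equals `k`, for `Y` uniformly distributed
in the (nonempty) finite set `B`. -/
noncomputable def prob {n : ℕ} (B : Finset (Fin n → ℤ)) (x : Fin n → ℤ) (k : ℤ) : ℝ :=
  ((B.filter fun y => ∑ j, x j * y j = k).card : ℝ) / (B.card : ℝ)

open Classical in
/-- The directions `x ∈ A` for which `max_k Pr[⟨x, Y⟩ = k] ≤ t` fails. -/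
noncomputable def badDirections {n : ℕ} (A B : Finset (Fin n → ℤ)) (t : ℝ) :
    Finset (Fin n → ℤ) :=
  A.filter fun x => ¬ ∀ k : ℤ, prob B x k ≤ t

/-- The solutions `(ε, s)` with `ε ∈ {±1}^4` and `s ∈ S^4` of the equation
`ε_1 s_1 + ε_2 s_2 = ε_3 s_3 + ε_4 s_4`. -/
def sidonSolutions (S : Finset ℤ) : Finset ((Fin 4 → ℤ) × (Fin 4 → ℤ)) :=
  (signCube 4 ×ˢ Fintype.piFinset fun _ => S).filter fun p =>
    p.1 0 * p.2 0 + p.1 1 * p.2 1 = p.1 2 * p.2 2 + p.1 3 * p.2 3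

/-- `S` is a weak Sidon set: the equation above has at most `100 |S|^2` solutions. -/
def IsWeakSidon (S : Finset ℤ) : Prop :=
  (sidonSolutions S).card ≤ 100 * S.card ^ 2

end TwoCube

/-!
Write `e t = exp (2 π i t)`, `d j = u j - v j` and let `charFun B x θ` be the mean over `y ∈ B` of
`e (θ ⟨x, y⟩)`. Fourier inversion bounds every `prob B x k` by the integral of `|charFun B x θ|`
over `θ ∈ [0, 1]`. The frequencies are split according to whether at least `δ n / 3` of the
coordinates are *degenerate*, that is, satisfy `|sin (2 π d_j θ)| < r`, where `r ^ 2` is a large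
multiple of `log n / n`.

At a nondegenerate frequency, the sum over `x` in the two-cube of `|charFun B x θ| ^ q` is at most
about `2 ^ (n + δ n) / |B|` for `q` of order `r ^ (-2)` (`exists_moment_bound`). This is a
Hausdorff-Young bound from `ℓ^p` to `ℓ^q`, with `p` conjugate to `q`, which tensorizes by
Minkowski's inequality (`tensor_bound`). Its one-coordinate case is a two-point inequality
(`exists_two_point`) whose constant is within `1 + ε` of that of the Hadamard matrix as soon as
`q * sin (2 π d_j θ) ^ 2` is large. Since `n ^ (-3 q)` is at least `2 ^ (-δ n / 3)` for large `n`,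
Markov's inequality shows that for all but the permitted number of directions the nondegenerate
frequencies contribute at most `n ^ (-3)` (`card_badDirections_mul_pow_le`).

It remains to bound the measure of the degenerate frequencies. By `freq_le_nearCount_le` it is
`O(r)` times the measure of the frequencies at which a positive proportion of the coordinates is
degenerate at a small constant scale: translating `θ` by an amount of order `1 / D`, where `D` is
a median of the `|d_j|` over the degenerate coordinates, preserves degeneracy at constant scale for
the `d_j` below `D`, but preserves degeneracy at scale `r` of those above `D` only with
probability `O(r)`. The measure at constant scale is trivially at most `1`. A Fejér kernel shows that
there one of finitely many exponential sums `∑ j, e (k d_j θ)` has size of order `n`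
(`exists_large_sum`), so Chebyshev's inequality gives `O(1 / n)` from the second moment when the
`d_j` are distinct, and `O(1 / n ^ 2)` from the fourth moment when they form a weak Sidon set.
-/

namespace TwoCube

open MeasureTheory

/-! ### The two-point inequality -/

lemma exists_binEntropy_le {h : ℝ} (hh : 0 < h) :
    ∃ κ : ℝ, 0 < κ ∧ ∀ x : ℝ, 0 ≤ x → x ≤ 1 → 4 * (x * (1 - x)) ≤ κ →
      Real.binEntropy x ≤ h := by
  obtain ⟨η, hη, H⟩ := Metric.continuousAt_iff.1
    (Real.binEntropy_continuous.continuousAt (x := 0)) h hh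
  have key : ∀ x : ℝ, 0 ≤ x → x ≤ 1 / 2 → 4 * (x * (1 - x)) ≤ η → Real.binEntropy x ≤ h := by
    intro x h0 h1 h2
    have hx : x < η := by nlinarith
    have := H (x := x) (by rw [Real.dist_eq, sub_zero, abs_of_nonneg h0]; exact hx)
    rw [Real.dist_eq, Real.binEntropy_zero, sub_zero] at this
    exact (le_abs_self _).trans this.le
  refine ⟨η, hη, fun x h0 h1 h2 => ?_⟩
  rcases le_total x (1 / 2) with hx | hx
  · exact key x h0 hx h2
  · rw [← Real.binEntropy_one_sub]
    exact key (1 - x) (by linarith) (by linarith) (by linarith)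

lemma exp_neg_binEntropy {x : ℝ} (h0 : 0 ≤ x) (h1 : x ≤ 1) :
    Real.exp (-Real.binEntropy x) = x ^ x * (1 - x) ^ (1 - x) := by
  have aux : ∀ y : ℝ, 0 ≤ y → y ^ y = Real.exp (y * Real.log y) := by
    intro y hy
    rcases hy.eq_or_lt with rfl | hy
    · simp
    · rw [Real.rpow_def_of_pos hy, mul_comm]
  rw [aux x h0, aux (1 - x) (by linarith), ← Real.exp_add, Real.binEntropy,
    Real.log_inv, Real.log_inv]
  ring_nf

lemma rpow_one_add_inv_pow {r : ℝ} (hr : 0 ≤ r) {m : ℕ} (hm : m ≠ 0) :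
    (r ^ (1 + (m : ℝ)⁻¹)) ^ m = r ^ (m + 1) := by
  rw [← Real.rpow_natCast, ← Real.rpow_mul hr, ← Real.rpow_natCast]
  congr 1
  have : (m : ℝ) ≠ 0 := by exact_mod_cast hm
  push_cast
  field_simp

/-- A lower bound for the `ℓ^p` norm of a pair with `p = 1 + 1 / m`, which improves on the power
mean inequality when the two entries are far apart, uniformly in `m`. -/
lemma exp_neg_binEntropy_mul_le {r s : ℝ} (hr : 0 ≤ r) (hs : 0 ≤ s) {m : ℕ} (hm : m ≠ 0) :
    Real.exp (-Real.binEntropy (r / (r + s))) * (r + s) ^ (m + 1) ≤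
      (r ^ (1 + (m : ℝ)⁻¹) + s ^ (1 + (m : ℝ)⁻¹)) ^ m := by
  rcases (add_nonneg hr hs).eq_or_lt with h | h
  · rw [← h]
    simp only [ne_eq, Nat.add_eq_zero_iff, one_ne_zero, and_false, not_false_eq_true, zero_pow,
      mul_zero]
    positivity
  set S := r + s with hS
  have hm' : (m : ℝ) ≠ 0 := by exact_mod_cast hm
  have h0 : 0 ≤ r / S := by positivity
  have h1 : 1 - r / S = s / S := by field_simp; linarith
  have h2 : 0 ≤ s / S := by positivity
  have amgm := Real.geom_mean_le_arith_mean2_weighted h0 h2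
    (Real.rpow_nonneg h0 (m : ℝ)⁻¹) (Real.rpow_nonneg h2 (m : ℝ)⁻¹) (by linarith)
  have e1 : ∀ y : ℝ, 0 ≤ y → (y ^ (m : ℝ)⁻¹) ^ m = y := by
    intro y hy
    exact Real.rpow_inv_natCast_pow hy hm
  have e2 : ∀ y : ℝ, 0 ≤ y → ((y ^ (m : ℝ)⁻¹) ^ y) ^ m = y ^ y := by
    intro y hy
    rw [← Real.rpow_natCast, ← Real.rpow_mul (Real.rpow_nonneg hy _), mul_comm,
      Real.rpow_mul (Real.rpow_nonneg hy _), Real.rpow_natCast, e1 y hy]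
  have e3 : ∀ y : ℝ, 0 ≤ y → y / S * (y / S) ^ (m : ℝ)⁻¹ =
      y ^ (1 + (m : ℝ)⁻¹) / S ^ (1 + (m : ℝ)⁻¹) := by
    intro y hy
    rw [← Real.div_rpow hy h.le, Real.rpow_add_of_nonneg (by positivity) zero_le_one
      (by positivity), Real.rpow_one]
  rw [e3 r hr, e3 s hs, ← add_div] at amgm
  have := pow_le_pow_left₀ (by positivity) amgm m
  rw [mul_pow, e2 _ h0, e2 _ h2, div_pow, rpow_one_add_inv_pow h.le hm, ← h1,
    ← exp_neg_binEntropy h0 (by linarith)] at this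
  rwa [le_div_iff₀ (by positivity)] at this

lemma add_pow_le_two_mul {r s : ℝ} (hr : 0 ≤ r) (hs : 0 ≤ s) {m : ℕ} (hm : m ≠ 0) :
    (r + s) ^ (m + 1) ≤ 2 * (r ^ (1 + (m : ℝ)⁻¹) + s ^ (1 + (m : ℝ)⁻¹)) ^ m := by
  have h := exp_neg_binEntropy_mul_le hr hs hm
  have h1 : (2 : ℝ)⁻¹ ≤ Real.exp (-Real.binEntropy (r / (r + s))) := by
    rw [← Real.exp_log (show (0 : ℝ) < 2⁻¹ by norm_num), Real.exp_le_exp, Real.log_inv]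
    linarith [Real.binEntropy_le_log_two (p := r / (r + s))]
  have h2 : (2 : ℝ)⁻¹ * (r + s) ^ (m + 1) ≤ _ :=
    (mul_le_mul_of_nonneg_right h1 (by positivity)).trans h
  linarith

/-- The real form of the two-point inequality. When `r * s` is comparable with `(r + s) ^ 2`, one
of `X`, `Y` is much smaller than `r + s` and the power mean inequality suffices; otherwise the
entropy bound for `(r ^ p + s ^ p) ^ m` gains the missing factor. -/
lemma exists_two_point {ε : ℝ} (hε : 0 < ε) :
    ∃ K : ℝ, 0 < K ∧ ∀ (m : ℕ) (φ r s X Y : ℝ), m ≠ 0 → 0 ≤ φ → K ≤ (m + 1) * φ →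
      0 ≤ r → 0 ≤ s → 0 ≤ X → 0 ≤ Y → X ≤ r + s → Y ≤ r + s →
      X ^ 2 + Y ^ 2 ≤ 2 * (r + s) ^ 2 - 2 * (r * s) * φ →
      X ^ (m + 1) + Y ^ (m + 1) ≤
        2 * (1 + ε) * (r ^ (1 + (m : ℝ)⁻¹) + s ^ (1 + (m : ℝ)⁻¹)) ^ m := by
  obtain ⟨κ, hκ, H⟩ := exists_binEntropy_le (Real.log_pos (show 1 < 1 + ε by linarith))
  set K := 8 / κ * |Real.log ε| + 1 with hK
  have hK0 : 0 < K := by positivity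
  have hKε : Real.exp (-(κ * K / 8)) ≤ ε := by
    rw [← Real.le_log_iff_exp_le hε]
    have : κ * K / 8 = |Real.log ε| + κ / 8 := by rw [hK]; field_simp
    rw [this]
    linarith [neg_abs_le (Real.log ε)]
  refine ⟨K, hK0, ?_⟩
  have key : ∀ (m : ℕ) (φ r s X Y : ℝ), m ≠ 0 → 0 ≤ φ → K ≤ (m + 1) * φ →
      0 ≤ r → 0 ≤ s → 0 ≤ X → 0 ≤ Y → X ≤ r + s → Y ≤ r + s →
      X ^ 2 ≤ (r + s) ^ 2 - (r * s) * φ →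
      X ^ (m + 1) + Y ^ (m + 1) ≤
        2 * (1 + ε) * (r ^ (1 + (m : ℝ)⁻¹) + s ^ (1 + (m : ℝ)⁻¹)) ^ m := by
    intro m φ r s X Y hm hφ hKφ hr hs hX hY hXS hYS hsq
    set S := r + s with hS
    have hS0 : 0 ≤ S := by positivity
    have hYp : Y ^ (m + 1) ≤ S ^ (m + 1) := pow_le_pow_left₀ hY hYS _
    have hXp : X ^ (m + 1) ≤ S ^ (m + 1) := pow_le_pow_left₀ hX hXS _
    rcases le_total (κ * S ^ 2) (4 * (r * s)) with hc | hc
    · have hX' : X ≤ S * Real.exp (-(κ * φ / 8)) := by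
        apply le_of_sq_le_sq _ (by positivity)
        rw [mul_pow, ← Real.exp_nat_mul]
        have e := Real.add_one_le_exp ((2 : ℕ) * (-(κ * φ / 8)))
        have : S ^ 2 * (((2 : ℕ) : ℝ) * (-(κ * φ / 8)) + 1) ≤ S ^ 2 * _ :=
          mul_le_mul_of_nonneg_left e (by positivity)
        push_cast at this ⊢
        nlinarith [mul_le_mul_of_nonneg_right hc hφ]
      have hX'' : X ^ (m + 1) ≤ S ^ (m + 1) * ε := by
        refine (pow_le_pow_left₀ hX hX' _).trans ?_
        rw [mul_pow, ← Real.exp_nat_mul]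
        refine mul_le_mul_of_nonneg_left (le_trans (Real.exp_le_exp.2 ?_) hKε) (by positivity)
        push_cast
        nlinarith
      have := add_pow_le_two_mul hr hs hm
      nlinarith
    · have hS2 : S = 0 ∨ 0 < S := hS0.eq_or_lt'
      have hent : Real.binEntropy (r / S) ≤ Real.log (1 + ε) := by
        rcases hS2 with h | h
        · rw [h]
          simpa using Real.log_nonneg (by linarith)
        · apply H
          · positivity
          · rw [div_le_one h]; linarith
          · have : 1 - r / S = s / S := by field_simp; linarith
            rw [this, div_mul_div_comm, ← mul_div_assoc, div_le_iff₀ (by positivity)]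
            nlinarith
      have h := exp_neg_binEntropy_mul_le hr hs hm
      rw [← hS] at h
      have h1 : (1 + ε)⁻¹ ≤ Real.exp (-Real.binEntropy (r / S)) := by
        rw [← Real.exp_log (show (0 : ℝ) < (1 + ε)⁻¹ by positivity), Real.exp_le_exp,
          Real.log_inv]
        linarith
      have h2 := (mul_le_mul_of_nonneg_right h1 (by positivity)).trans h
      rw [inv_mul_le_iff₀ (by positivity)] at h2
      linarith
  intro m φ r s X Y hm hφ hKφ hr hs hX hY hXS hYS hsq
  rcases le_total (X ^ 2) (Y ^ 2) with h | h
  · exact key m φ r s X Y hm hφ hKφ hr hs hX hY hXS hYS (by linarith)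
  · rw [add_comm]
    exact key m φ r s Y X hm hφ hKφ hr hs hY hX hYS hXS (by linarith)

lemma norm_sq_add_norm_sq_le {a b z₁ z₂ w₁ w₂ : ℂ} {φ : ℝ} (hz₁ : ‖z₁‖ = 1) (hz₂ : ‖z₂‖ = 1)
    (hw₁ : ‖w₁‖ = 1) (hw₂ : ‖w₂‖ = 1)
    (h : ‖z₁ * (starRingEnd ℂ) z₂ + w₁ * (starRingEnd ℂ) w₂‖ ≤ 2 - φ) :
    ‖a * z₁ + b * z₂‖ ^ 2 + ‖a * w₁ + b * w₂‖ ^ 2 ≤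
      2 * (‖a‖ + ‖b‖) ^ 2 - 2 * (‖a‖ * ‖b‖) * φ := by
  have e : ∀ x y : ℂ, ‖x + y‖ ^ 2 = ‖x‖ ^ 2 + ‖y‖ ^ 2 + 2 * (x * (starRingEnd ℂ) y).re := by
    intro x y
    rw [← Complex.normSq_eq_norm_sq, ← Complex.normSq_eq_norm_sq, ← Complex.normSq_eq_norm_sq,
      Complex.normSq_add]
  rw [e, e]
  simp only [norm_mul, hz₁, hz₂, hw₁, hw₂, mul_one]
  have : (a * z₁ * (starRingEnd ℂ) (b * z₂)).re + (a * w₁ * (starRingEnd ℂ) (b * w₂)).re ≤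
      ‖a‖ * ‖b‖ * (2 - φ) := by
    rw [← Complex.add_re]
    refine (Complex.re_le_norm _).trans ?_
    have : a * z₁ * (starRingEnd ℂ) (b * z₂) + a * w₁ * (starRingEnd ℂ) (b * w₂) =
        a * (starRingEnd ℂ) b * (z₁ * (starRingEnd ℂ) z₂ + w₁ * (starRingEnd ℂ) w₂) := by
      simp only [map_mul]; ring
    rw [this, norm_mul, norm_mul, RCLike.norm_conj]
    exact mul_le_mul_of_nonneg_left h (by positivity)
  nlinarith

/-- The character `t ↦ exp (2 π i t)` of the real line. -/
noncomputable def e (t : ℝ) : ℂ := Complex.exp (2 * Real.pi * t * Complex.I)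

lemma e_add (s t : ℝ) : e (s + t) = e s * e t := by
  rw [e, e, e, ← Complex.exp_add]
  push_cast
  ring_nf

@[simp] lemma e_zero : e 0 = 1 := by simp [e]

@[simp] lemma norm_e (t : ℝ) : ‖e t‖ = 1 := by
  have : (2 * Real.pi * t * Complex.I : ℂ) = ((2 * Real.pi * t : ℝ) : ℂ) * Complex.I := by
    push_cast; ring
  rw [e, this, Complex.norm_exp_ofReal_mul_I]

lemma conj_e (t : ℝ) : (starRingEnd ℂ) (e t) = e (-t) := by
  rw [e, e, ← Complex.exp_conj]
  simp [map_ofNat]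

lemma e_sum {ι : Type*} (s : Finset ι) (f : ι → ℝ) : e (∑ i ∈ s, f i) = ∏ i ∈ s, e (f i) := by
  classical
  induction s using Finset.induction_on with
  | empty => simp
  | insert a s ha ih => rw [Finset.sum_insert ha, Finset.prod_insert ha, e_add, ih]

lemma continuous_e : Continuous e := by
  unfold e; fun_prop

lemma norm_e_add_one (t : ℝ) : ‖e t + 1‖ = 2 * |Real.cos (Real.pi * t)| := by
  have h : e t + 1 = e (t / 2) * (2 * Complex.cos (Real.pi * t)) := by
    rw [Complex.two_cos, e, e, mul_add, ← Complex.exp_add, ← Complex.exp_add,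
      ← Complex.exp_zero]
    push_cast
    ring_nf
  have h2 : (2 * Complex.cos (Real.pi * t) : ℂ) = ((2 * Real.cos (Real.pi * t) : ℝ) : ℂ) := by
    push_cast; ring
  rw [h, norm_mul, norm_e, one_mul, h2, Complex.norm_real, Real.norm_eq_abs, abs_mul]
  simp

lemma norm_e_sub_one (t : ℝ) : ‖e t - 1‖ = 2 * |Real.sin (Real.pi * t)| := by
  have h : e t - 1 = e (t / 2) * (Complex.I * (2 * Complex.sin (Real.pi * t))) := by
    have : Complex.I * (2 * Complex.sin (Real.pi * t)) =
        Complex.exp (Real.pi * t * Complex.I) - Complex.exp (-(Real.pi * t) * Complex.I) := by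
      rw [Complex.two_sin]
      linear_combination (Complex.exp (-(Real.pi * t) * Complex.I) -
        Complex.exp (Real.pi * t * Complex.I)) * Complex.I_mul_I
    rw [this, e, e, mul_sub, ← Complex.exp_add, ← Complex.exp_add,
      ← Complex.exp_zero]
    push_cast
    ring_nf
  have h2 : (2 * Complex.sin (Real.pi * t) : ℂ) = ((2 * Real.sin (Real.pi * t) : ℝ) : ℂ) := by
    push_cast; ring
  rw [h, norm_mul, norm_e, one_mul, norm_mul, Complex.norm_I, one_mul, h2, Complex.norm_real,
    Real.norm_eq_abs, abs_mul]
  simp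

/-- The two columns of the matrix `e (θ x y)`, `x ∈ {u, v}`, `y ∈ {1, -1}`, are nearly orthogonal
when `sin (2 π θ (u - v))` is large. -/
lemma norm_phase_add_phase_le (θ u v : ℝ) :
    ‖e (θ * u) * (starRingEnd ℂ) (e (-(θ * u))) + e (θ * v) * (starRingEnd ℂ) (e (-(θ * v)))‖ ≤
      2 - Real.sin (2 * Real.pi * ((u - v) * θ)) ^ 2 := by
  rw [conj_e, conj_e, neg_neg, neg_neg, ← e_add, ← e_add]
  have : e (θ * u + θ * u) + e (θ * v + θ * v) =
      e (θ * v + θ * v) * (e (2 * ((u - v) * θ)) + 1) := by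
    rw [mul_add, mul_one, ← e_add]
    ring_nf
  rw [this, norm_mul, norm_e, one_mul, norm_e_add_one]
  have h2 : Real.pi * (2 * ((u - v) * θ)) = 2 * Real.pi * ((u - v) * θ) := by ring
  rw [h2]
  have := Real.sin_sq_add_cos_sq (2 * Real.pi * ((u - v) * θ))
  nlinarith [sq_abs (Real.cos (2 * Real.pi * ((u - v) * θ))),
    sq_nonneg (|Real.cos (2 * Real.pi * ((u - v) * θ))| - 1)]

/-! ### Tensorization over the two-cube -/

lemma sum_piFinset_succ {n : ℕ} {X M : Type*} [AddCommMonoid M]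
    (S : Fin (n + 1) → Finset X) (F : (Fin (n + 1) → X) → M) :
    ∑ x ∈ Fintype.piFinset S, F x =
      ∑ a ∈ S 0, ∑ x ∈ Fintype.piFinset (fun j => S j.succ), F (Fin.cons a x) := by
  rw [← Finset.sum_product']
  symm
  refine Finset.sum_equiv (Fin.consEquiv fun _ => X) ?_ ?_
  · rintro ⟨a, x⟩
    simp [Fintype.mem_piFinset, Fin.forall_fin_succ]
  · rintro ⟨a, x⟩ _
    rfl

/-- Minkowski's inequality in `ℓ^m`, stated without roots. -/
lemma sum_add_pow_le {ι : Type*} (s : Finset ι) (f g : ι → ℝ) {m : ℕ} (hm : m ≠ 0)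
    (hf : ∀ i, 0 ≤ f i) (hg : ∀ i, 0 ≤ g i) {C a b : ℝ} (hC : 0 ≤ C) (ha : 0 ≤ a) (hb : 0 ≤ b)
    (h1 : ∑ i ∈ s, f i ^ m ≤ C * a ^ m) (h2 : ∑ i ∈ s, g i ^ m ≤ C * b ^ m) :
    ∑ i ∈ s, (f i + g i) ^ m ≤ C * (a + b) ^ m := by
  have hm1 : (1 : ℝ) ≤ m := by exact_mod_cast Nat.one_le_iff_ne_zero.2 hm
  have h := Real.Lp_add_le_of_nonneg (s := s) (f := f) (g := g) hm1
    (fun i _ => hf i) (fun i _ => hg i)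
  simp only [Real.rpow_natCast, one_div] at h
  have root : ∀ F : ι → ℝ, (∀ i, 0 ≤ F i) → ∀ c : ℝ, 0 ≤ c → ∑ i ∈ s, F i ^ m ≤ C * c ^ m →
      (∑ i ∈ s, F i ^ m) ^ (m : ℝ)⁻¹ ≤ C ^ (m : ℝ)⁻¹ * c := by
    intro F hF c hc hh
    refine (Real.rpow_le_rpow (Finset.sum_nonneg fun i _ => pow_nonneg (hF i) _) hh
      (by positivity)).trans_eq ?_
    rw [Real.mul_rpow hC (by positivity), Real.pow_rpow_inv_natCast hc hm]
  have h3 := h.trans (add_le_add (root f hf a ha h1) (root g hg b hb h2))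
  have hs : 0 ≤ ∑ i ∈ s, (f i + g i) ^ m :=
    Finset.sum_nonneg fun i _ => pow_nonneg (add_nonneg (hf i) (hg i)) _
  have h4 := pow_le_pow_left₀ (Real.rpow_nonneg hs _) h3 m
  rwa [Real.rpow_inv_natCast_pow hs hm, ← mul_add, mul_pow, Real.rpow_inv_natCast_pow hC hm] at h4

/-- If each of the `n` kernels `k j` satisfies an `ℓ^p → ℓ^(m + 1)` bound with `p = 1 + 1 / m`,
then so does their tensor product, with the product of the constants. -/
lemma tensor_bound {m : ℕ} (hm : m ≠ 0) : ∀ {n : ℕ} (S : Fin n → Finset ℤ)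
    (k : Fin n → ℤ → ℤ → ℂ) (C : Fin n → ℝ), (∀ j, 0 ≤ C j) →
    (∀ j (a b : ℂ), ∑ x ∈ S j, ‖a * k j x 1 + b * k j x (-1)‖ ^ (m + 1) ≤
      C j * (‖a‖ ^ (1 + (m : ℝ)⁻¹) + ‖b‖ ^ (1 + (m : ℝ)⁻¹)) ^ m) →
    ∀ f : (Fin n → ℤ) → ℂ,
      ∑ x ∈ Fintype.piFinset S, ‖∑ y ∈ signCube n, f y * ∏ j, k j (x j) (y j)‖ ^ (m + 1) ≤
        (∏ j, C j) * (∑ y ∈ signCube n, ‖f y‖ ^ (1 + (m : ℝ)⁻¹)) ^ m := by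
  intro n
  induction n with
  | zero =>
    intro S k C _ _ f
    have : signCube 0 = {default} := by
      ext y; simp [signCube, eq_iff_true_of_subsingleton]
    have h2 : Fintype.piFinset S = {default} := by
      ext y; simp [eq_iff_true_of_subsingleton]
    rw [this, h2]
    simp [rpow_one_add_inv_pow (norm_nonneg _) hm]
  | succ n ih =>
    intro S k C hC H f
    set p : ℝ := 1 + (m : ℝ)⁻¹ with hp
    have split : ∀ {M : Type} [AddCommMonoid M] (F : (Fin (n + 1) → ℤ) → M),
        ∑ y ∈ signCube (n + 1), F y =
          ∑ y ∈ signCube n, F (Fin.cons 1 y) + ∑ y ∈ signCube n, F (Fin.cons (-1) y) := by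
      intro M _ F
      rw [signCube, sum_piFinset_succ, Finset.sum_pair (by norm_num)]
      rfl
    set G : ℤ → (Fin n → ℤ) → ℂ := fun b x =>
      ∑ y ∈ signCube n, f (Fin.cons b y) * ∏ j, k j.succ (x j) (y j) with hG
    set N : ℤ → ℝ := fun b => ∑ y ∈ signCube n, ‖f (Fin.cons b y)‖ ^ p with hN
    have hN0 : ∀ b, 0 ≤ N b := fun b => Finset.sum_nonneg fun y _ => by positivity
    have hGb : ∀ b, ∑ x ∈ Fintype.piFinset (fun j => S j.succ), (‖G b x‖ ^ p) ^ m ≤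
        (∏ j : Fin n, C j.succ) * N b ^ m := by
      intro b
      simp only [hp, rpow_one_add_inv_pow (norm_nonneg _) hm]
      exact ih (fun j => S j.succ) (fun j => k j.succ) (fun j => C j.succ) (fun j => hC _)
        (fun j => H _) (fun y => f (Fin.cons b y))
    have hmink := sum_add_pow_le (Fintype.piFinset fun j => S j.succ) (fun x => ‖G 1 x‖ ^ p)
      (fun x => ‖G (-1) x‖ ^ p) hm (fun x => by positivity) (fun x => by positivity)
      (Finset.prod_nonneg fun j _ => hC _) (hN0 1) (hN0 (-1)) (hGb 1) (hGb (-1))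
    have hF : ∀ (a : ℤ) (x : Fin n → ℤ),
        ∑ y ∈ signCube (n + 1), f y *
          ∏ j, k j ((Fin.cons a x : Fin (n + 1) → ℤ) j) (y j) =
          G 1 x * k 0 a 1 + G (-1) x * k 0 a (-1) := by
      intro a x
      rw [split, hG]
      simp only [Fin.prod_univ_succ, Fin.cons_zero, Fin.cons_succ, Finset.sum_mul]
      congr 1 <;> exact Finset.sum_congr rfl fun y _ => by ring
    rw [sum_piFinset_succ, Finset.sum_comm, split, Fin.prod_univ_succ]
    simp only [hF]
    calc _ ≤ ∑ x ∈ Fintype.piFinset (fun j => S j.succ),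
          C 0 * (‖G 1 x‖ ^ p + ‖G (-1) x‖ ^ p) ^ m :=
          Finset.sum_le_sum fun x _ => H 0 _ _
      _ ≤ _ := by
          rw [← Finset.mul_sum, mul_assoc]
          exact mul_le_mul_of_nonneg_left hmink (hC 0)

/-- The characteristic function of `⟨x, Y⟩` for `Y` uniformly distributed in `B`. -/
noncomputable def charFun {n : ℕ} (B : Finset (Fin n → ℤ)) (x : Fin n → ℤ) (θ : ℝ) : ℂ :=
  (∑ y ∈ B, e (θ * ((∑ j, x j * y j : ℤ) : ℝ))) / (B.card : ℂ)

/-- The number of coordinates `j` that are degenerate at scale `r` and frequency `θ`: those with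
`|sin (2 π d_j θ)| < r`. -/
noncomputable def nearCount {n : ℕ} (d : Fin n → ℤ) (r θ : ℝ) : ℕ :=
  (Finset.univ.filter fun j => |Real.sin (2 * Real.pi * (d j * θ))| < r).card

/-- The moment bound that replaces the Hausdorff-Young inequality: at a frequency `θ` with few
exceptional coordinates, the `q`-th moment of the characteristic function over the two-cube is
nearly as small as if the matrix `e (θ ⟨x, y⟩)` were a Hadamard matrix. -/
lemma exists_moment_bound {ε : ℝ} (hε : 0 < ε) :
    ∃ K : ℝ, 0 < K ∧ ∀ (n m : ℕ) (u v : Fin n → ℤ) (B : Finset (Fin n → ℤ)) (r θ : ℝ),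
      (∀ j, u j ≠ v j) → B ⊆ signCube n → B.Nonempty → m ≠ 0 → 0 ≤ r →
      K ≤ (m + 1) * r ^ 2 →
      ∑ x ∈ twoCube u v, ‖charFun B x θ‖ ^ (m + 1) ≤
        2 ^ n * (1 + ε) ^ n * 2 ^ nearCount (fun j => u j - v j) r θ / B.card := by
  obtain ⟨K, hK0, HK⟩ := exists_two_point hε
  refine ⟨K, hK0, fun n m u v B r θ huv hB hBne hm hr hK => ?_⟩
  classical
  set bad : Fin n → Prop :=
    fun j => |Real.sin (2 * Real.pi * (((u j - v j : ℤ) : ℝ) * θ))| < r with hbad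
  set C : Fin n → ℝ := fun j => 2 * (1 + ε) * if bad j then 2 else 1 with hC
  have hC0 : ∀ j, 0 ≤ C j := fun j => by simp only [hC]; positivity
  have htp : ∀ j (a b : ℂ), ∑ x ∈ ({u j, v j} : Finset ℤ),
      ‖a * e (θ * ((x * 1 : ℤ) : ℝ)) + b * e (θ * ((x * (-1) : ℤ) : ℝ))‖ ^ (m + 1) ≤
      C j * (‖a‖ ^ (1 + (m : ℝ)⁻¹) + ‖b‖ ^ (1 + (m : ℝ)⁻¹)) ^ m := by
    intro j a b
    rw [Finset.sum_pair (huv j)]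
    have hb : ∀ t : ℝ, ‖a * e t + b * e (-t)‖ ≤ ‖a‖ + ‖b‖ := by
      intro t
      refine (norm_add_le _ _).trans ?_
      simp
    have conv : ∀ x : ℤ, ‖a * e (θ * ((x * 1 : ℤ) : ℝ)) + b * e (θ * ((x * (-1) : ℤ) : ℝ))‖ =
        ‖a * e (θ * x) + b * e (-(θ * x))‖ := by
      intro x
      push_cast
      ring_nf
    rw [conv, conv]
    -- A degenerate coordinate costs at most a factor `2`, by the power mean inequality.
    by_cases hj : bad j
    · have h1 := pow_le_pow_left₀ (norm_nonneg _) (hb (θ * u j)) (m + 1)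
      have h2 := pow_le_pow_left₀ (norm_nonneg _) (hb (θ * v j)) (m + 1)
      have h3 := add_pow_le_two_mul (norm_nonneg a) (norm_nonneg b) hm
      have h4 : 0 ≤ (‖a‖ ^ (1 + (m : ℝ)⁻¹) + ‖b‖ ^ (1 + (m : ℝ)⁻¹)) ^ m := by positivity
      simp only [hC, hj, if_true]
      nlinarith
    · simp only [hC, hj, if_false, mul_one]
      refine HK m (Real.sin (2 * Real.pi * (((u j : ℝ) - v j) * θ)) ^ 2) ‖a‖ ‖b‖ _ _ hm
        (sq_nonneg _) ?_ (norm_nonneg _) (norm_nonneg _) (norm_nonneg _) (norm_nonneg _)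
        (hb _) (hb _) ?_
      · refine hK.trans (mul_le_mul_of_nonneg_left ?_ (by positivity))
        simp only [hbad, not_lt] at hj
        push_cast at hj
        rw [← sq_abs (Real.sin _)]
        exact pow_le_pow_left₀ hr hj 2
      · exact norm_sq_add_norm_sq_le (norm_e _) (norm_e _) (norm_e _) (norm_e _)
          (norm_phase_add_phase_le _ _ _)
  have hT := tensor_bound hm (fun j => ({u j, v j} : Finset ℤ))
    (fun _ x y => e (θ * ((x * y : ℤ) : ℝ))) C hC0 htp (fun y => if y ∈ B then 1 else 0)
  have hprod : ∏ j, C j = 2 ^ n * (1 + ε) ^ n * 2 ^ nearCount (fun j => u j - v j) r θ := by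
    simp only [hC, Finset.prod_mul_distrib, Finset.prod_const, Finset.card_univ,
      Fintype.card_fin, Finset.prod_ite, one_pow, mul_one, nearCount]
    simp only [hbad]
  have hsum1 : ∑ y ∈ signCube n, ‖(if y ∈ B then 1 else 0 : ℂ)‖ ^ (1 + (m : ℝ)⁻¹) = B.card := by
    have : ∀ y : Fin n → ℤ, ‖(if y ∈ B then 1 else 0 : ℂ)‖ ^ (1 + (m : ℝ)⁻¹) =
        if y ∈ B then (1 : ℝ) else 0 := by
      intro y
      split_ifs
      · simp
      · rw [norm_zero, Real.zero_rpow (by positivity)]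
    simp only [this]
    rw [← Finset.sum_filter, Finset.filter_mem_eq_inter, Finset.inter_eq_right.2 hB]
    simp
  have hsum2 : ∀ x : Fin n → ℤ, ∑ y ∈ signCube n, (if y ∈ B then (1 : ℂ) else 0) *
      ∏ j, e (θ * ((x j * y j : ℤ) : ℝ)) = B.card * charFun B x θ := by
    intro x
    have hB0 : (B.card : ℂ) ≠ 0 := by exact_mod_cast hBne.card_pos.ne'
    rw [charFun, mul_div_cancel₀ _ hB0]
    simp only [ite_mul, one_mul, zero_mul]
    rw [← Finset.sum_filter, Finset.filter_mem_eq_inter, Finset.inter_eq_right.2 hB]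
    refine Finset.sum_congr rfl fun y _ => ?_
    rw [← e_sum]
    push_cast
    rw [Finset.mul_sum]
  simp only [hsum2, hsum1, hprod, norm_mul, mul_pow, ← Finset.mul_sum] at hT
  have hBpos : (0 : ℝ) < B.card := by exact_mod_cast hBne.card_pos
  rw [Complex.norm_natCast] at hT
  rw [le_div_iff₀ hBpos]
  have h5 : (0 : ℝ) < (B.card : ℝ) ^ m := by positivity
  rw [pow_succ] at hT
  refine le_of_mul_le_mul_left ?_ h5
  unfold twoCube
  linarith

/-! ### Frequencies at which many coordinates are degenerate -/

lemma intervalIntegrable_of_bounded {f : ℝ → ℝ} (hf : Measurable f) {C : ℝ}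
    (hC : ∀ x, |f x| ≤ C) (a b : ℝ) : IntervalIntegrable f volume a b := by
  rw [intervalIntegrable_iff]
  exact Measure.integrableOn_of_bounded (M := C) (by simp) hf.aestronglyMeasurable
    (Filter.Eventually.of_forall fun x => by simpa using hC x)

lemma measurable_indicator_one {A : Set ℝ} (hA : MeasurableSet A) :
    Measurable (A.indicator (1 : ℝ → ℝ)) :=
  measurable_one.indicator hA

lemma abs_indicator_one_le (A : Set ℝ) (x : ℝ) : |A.indicator (1 : ℝ → ℝ) x| ≤ 1 := by
  by_cases h : x ∈ A <;> simp [h]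

lemma intervalIntegrable_indicator {A : Set ℝ} (hA : MeasurableSet A) (a b : ℝ) :
    IntervalIntegrable (A.indicator (1 : ℝ → ℝ)) volume a b :=
  intervalIntegrable_of_bounded (measurable_indicator_one hA) (abs_indicator_one_le A) a b

/-- The proportion of frequencies `θ ∈ [0, 1]` that lie in `A`. -/
noncomputable def freq (A : Set ℝ) : ℝ := ∫ θ in (0 : ℝ)..1, A.indicator (1 : ℝ → ℝ) θ

lemma freq_le_one {A : Set ℝ} (hA : MeasurableSet A) : freq A ≤ 1 := by
  have := intervalIntegral.integral_mono_on (f := A.indicator (1 : ℝ → ℝ)) (g := fun _ => 1)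
    zero_le_one (intervalIntegrable_indicator hA 0 1) (by simp)
    (fun x _ => (le_abs_self _).trans (abs_indicator_one_le A x))
  simpa [freq] using this

lemma measurable_card_filter {ι : Type*} [Fintype ι] (P : ι → ℝ → Prop)
    [∀ θ, DecidablePred fun j => P j θ] (hP : ∀ j, MeasurableSet {θ | P j θ}) :
    Measurable fun θ => ((Finset.univ.filter fun j => P j θ).card : ℝ) := by
  classical
  have : (fun θ => ((Finset.univ.filter fun j => P j θ).card : ℝ)) =
      fun θ => ∑ j, {θ | P j θ}.indicator (1 : ℝ → ℝ) θ := by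
    ext θ
    rw [Finset.card_filter]
    push_cast
    exact Finset.sum_congr rfl fun j _ => by simp [Set.indicator_apply]
  rw [this]
  exact Finset.measurable_sum _ fun j _ => measurable_indicator_one (hP j)

lemma measurableSet_near (r : ℝ) (d : ℤ) :
    MeasurableSet {θ : ℝ | |Real.sin (2 * Real.pi * (d * θ))| < r} :=
  measurableSet_lt (by fun_prop) measurable_const

lemma measurableSet_le_nearCount {n : ℕ} (d : Fin n → ℤ) (r s : ℝ) :
    MeasurableSet {θ : ℝ | s ≤ (nearCount d r θ : ℝ)} :=
  measurableSet_le measurable_const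
    (measurable_card_filter _ fun j => measurableSet_near r (d j))

/-- At least `s` elements of a set of size at least `3 s` are at distance `s` from both ends of
the ordering by `w`. -/
lemma le_card_medians {ι : Type*} [DecidableEq ι] (J : Finset ι) (w : ι → ℝ) {s : ℝ} (hs : 0 < s)
    (hJ : 3 * s ≤ J.card) :
    s ≤ (J.filter fun i => s ≤ (J.filter fun j => w j ≤ w i).card ∧
      s ≤ (J.filter fun j => w i ≤ w j).card).card := by
  have key : ∀ w : ι → ℝ,
      ((J.filter fun i => ((J.filter fun j => w j ≤ w i).card : ℝ) < s).card : ℝ) < s := by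
    intro w
    rcases (J.filter fun i => ((J.filter fun j => w j ≤ w i).card : ℝ) < s).eq_empty_or_nonempty
      with h | h
    · rw [h]; simpa using hs
    · obtain ⟨i, hi, hmax⟩ := Finset.exists_max_image _ w h
      refine lt_of_le_of_lt ?_ (Finset.mem_filter.1 hi).2
      exact_mod_cast Finset.card_le_card fun j hj =>
        Finset.mem_filter.2 ⟨(Finset.mem_filter.1 hj).1, hmax j hj⟩
  have h1 := key w
  have h2 := key fun i => - w i
  simp only [neg_le_neg_iff] at h2
  have h3 : J ⊆ (J.filter fun i => s ≤ (J.filter fun j => w j ≤ w i).card ∧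
      s ≤ (J.filter fun j => w i ≤ w j).card) ∪
      ((J.filter fun i => ((J.filter fun j => w j ≤ w i).card : ℝ) < s) ∪
      (J.filter fun i => ((J.filter fun j => w i ≤ w j).card : ℝ) < s)) := by
    intro i hi
    simp only [Finset.mem_union, Finset.mem_filter, hi, true_and]
    rcases lt_or_ge ((J.filter fun j => w j ≤ w i).card : ℝ) s with h | h
    · exact Or.inr (Or.inl h)
    rcases lt_or_ge ((J.filter fun j => w i ≤ w j).card : ℝ) s with h' | h'
    · exact Or.inr (Or.inr h')
    · exact Or.inl ⟨h, h'⟩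
  have h4 := (Finset.card_le_card h3).trans (Finset.card_union_le _ _)
  have h5 := h4.trans (Nat.add_le_add_left (Finset.card_union_le _ _) _)
  have h6 : (J.card : ℝ) ≤ _ := Nat.cast_le.2 h5
  push_cast at h6
  linarith

/-- In any window of length `ℓ`, the set where `|sin (2 π d τ)| < r` has measure at most
`ℓ r + r / (2 |d|)`. -/
lemma integral_near_le {d : ℤ} (hd : d ≠ 0) {r ℓ : ℝ} (hr : 0 ≤ r) (hℓ : 0 ≤ ℓ) (t : ℝ) :
    ∫ τ in t..t + ℓ, {θ : ℝ | |Real.sin (2 * Real.pi * (d * θ))| < r}.indicator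
      (1 : ℝ → ℝ) τ ≤ ℓ * r + r / (2 * |(d : ℝ)|) := by
  set A := {θ : ℝ | |Real.sin (2 * Real.pi * (d * θ))| < r} with hA
  have hAm : MeasurableSet A := measurableSet_near r d
  have hI := intervalIntegrable_indicator hAm
  have hd0 : (0 : ℝ) < |(d : ℝ)| := by positivity
  have hd' : (d : ℝ) ≠ 0 := by exact_mod_cast hd
  set T : ℝ := 1 / (2 * |(d : ℝ)|) with hT
  have hT0 : 0 < T := by positivity
  have hper : Function.Periodic (A.indicator (1 : ℝ → ℝ)) T := by
    intro x
    have : |Real.sin (2 * Real.pi * (d * (x + T)))| = |Real.sin (2 * Real.pi * (d * x))| := by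
      rcases abs_choice (d : ℝ) with h | h
      · have : 2 * Real.pi * (d * (x + T)) = 2 * Real.pi * (d * x) + Real.pi := by
          rw [hT, h]; field_simp
        rw [this, Real.sin_add_pi, abs_neg]
      · have : 2 * Real.pi * (d * (x + T)) = 2 * Real.pi * (d * x) - Real.pi := by
          rw [hT, h]; field_simp; ring
        rw [this, Real.sin_sub_pi, abs_neg]
    simp only [Set.indicator_apply, hA, Set.mem_ofPred_eq, this, Pi.one_apply]
  have hone : ∫ τ in t..t + T, A.indicator (1 : ℝ → ℝ) τ ≤ r * T := by
    rw [hper.intervalIntegral_add_eq t (-(T / 2))]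
    have e : -(T / 2) + T = T / 2 := by ring
    rw [e]
    set B : Set ℝ := Set.Icc (-(r * T / 2)) (r * T / 2) with hB
    have hle : ∀ x ∈ Set.Icc (-(T / 2)) (T / 2),
        A.indicator (1 : ℝ → ℝ) x ≤ B.indicator (1 : ℝ → ℝ) x := by
      intro x hx
      by_cases hxA : x ∈ A
      · have habs : |x| ≤ T / 2 := abs_le.2 hx
        have h1 : |2 * Real.pi * (d * x)| = 2 * Real.pi * (|(d : ℝ)| * |x|) := by
          rw [abs_mul, abs_mul, abs_mul, abs_of_pos Real.pi_pos, abs_two]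
        have h2 : |(d : ℝ)| * |x| ≤ 1 / 4 := by
          calc |(d : ℝ)| * |x| ≤ |(d : ℝ)| * (T / 2) := by gcongr
            _ = 1 / 4 := by rw [hT]; field_simp; norm_num
        have h3 := Real.mul_abs_le_abs_sin (x := 2 * Real.pi * (d * x))
          (by rw [h1]; nlinarith [Real.pi_pos])
        have h4 : |Real.sin (2 * Real.pi * (d * x))| < r := hxA
        rw [h1] at h3
        have h5 : 2 / Real.pi * (2 * Real.pi * (|(d : ℝ)| * |x|)) = 4 * |(d : ℝ)| * |x| := by
          field_simp; ring
        rw [h5] at h3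
        have h6 : |x| ≤ r * T / 2 := by
          have : r * T / 2 = r / (4 * |(d : ℝ)|) := by rw [hT]; field_simp; norm_num
          rw [this, le_div_iff₀ (by positivity)]
          linarith
        have hxB : x ∈ B := abs_le.1 h6
        simp [hxA, hxB]
      · simp only [hxA, not_false_eq_true, Set.indicator_of_notMem]
        exact Set.indicator_nonneg (by simp) _
    refine (intervalIntegral.integral_mono_on (by linarith) (hI _ _)
      (intervalIntegrable_indicator measurableSet_Icc _ _) hle).trans ?_
    rw [intervalIntegral.integral_of_le (by linarith), integral_indicator measurableSet_Icc,
      Measure.restrict_restrict measurableSet_Icc]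
    simp only [Pi.one_apply, integral_const, smul_eq_mul, mul_one]
    have h7 : volume.real (B ∩ Set.Ioc (-(T / 2)) (T / 2)) ≤ volume.real B :=
      measureReal_mono Set.inter_subset_left (by simp [hB])
    have h8 : volume.real B = r * T := by
      rw [hB, Real.volume_real_Icc_of_le (by nlinarith [mul_nonneg hr hT0.le])]
      ring
    simpa [h8] using h7
  set N := ⌈ℓ / T⌉ with hN
  have hN1 : ℓ ≤ N * T := by
    have := Int.le_ceil (ℓ / T)
    rwa [div_le_iff₀ hT0] at this
  have hN2 : (N : ℝ) ≤ ℓ / T + 1 := (Int.ceil_lt_add_one _).le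
  have hN0 : (0 : ℝ) ≤ N := by
    have : (0 : ℤ) ≤ N := Int.ceil_nonneg (by positivity)
    exact_mod_cast this
  calc ∫ τ in t..t + ℓ, A.indicator (1 : ℝ → ℝ) τ
      ≤ ∫ τ in t..t + N • T, A.indicator (1 : ℝ → ℝ) τ := by
        refine intervalIntegral.integral_mono_interval le_rfl (by linarith)
          (by simpa using hN1) ?_ (hI _ _)
        exact Filter.Eventually.of_forall fun x => Set.indicator_nonneg (by simp) _
    _ = N • ∫ τ in t..t + T, A.indicator (1 : ℝ → ℝ) τ :=
        hper.intervalIntegral_add_zsmul_eq N t hI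
    _ ≤ (ℓ / T + 1) * (r * T) := by
        rw [zsmul_eq_mul]
        exact mul_le_mul hN2 hone (intervalIntegral.integral_nonneg (by linarith)
          fun x _ => Set.indicator_nonneg (by simp) _) (by positivity)
    _ = ℓ * r + r / (2 * |(d : ℝ)|) := by
        rw [hT]; field_simp

/-- The frequencies at which at least `s` of the degenerate coordinates have difference at most
`D` and at least `s` of them have difference at least `D`. -/
def medianSet {n : ℕ} (d : Fin n → ℤ) (r s D : ℝ) : Set ℝ :=
  {θ | s ≤ ((Finset.univ.filter fun j => |Real.sin (2 * Real.pi * (d j * θ))| < r ∧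
      |(d j : ℝ)| ≤ D).card : ℝ)} ∩
  {θ | s ≤ ((Finset.univ.filter fun j => |Real.sin (2 * Real.pi * (d j * θ))| < r ∧
      D ≤ |(d j : ℝ)|).card : ℝ)}

lemma measurableSet_medianSet {n : ℕ} (d : Fin n → ℤ) (r s D : ℝ) :
    MeasurableSet (medianSet d r s D) := by
  refine MeasurableSet.inter ?_ ?_ <;>
  · refine measurableSet_le measurable_const (measurable_card_filter _ fun j => ?_)
    exact (measurableSet_near r (d j)).inter (MeasurableSet.const _)

/-- Translating a point of `medianSet` by at most `r' / (2 π D)` keeps the small coordinates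
degenerate, while the large coordinates are degenerate only for a fraction `O(r)` of such
translations. -/
lemma freq_medianSet_le {n : ℕ} (d : Fin n → ℤ) {r r' s D : ℝ} (hr : 0 ≤ r) (hr' : 0 < r')
    (hs : 0 < s) (hD : 0 < D) :
    freq (medianSet d r s D) ≤
      n / s * (r + Real.pi * r / r') * freq {θ | s ≤ (nearCount d (r + r') θ : ℝ)} := by
  set E := medianSet d r s D with hE
  set W := {θ | s ≤ (nearCount d (r + r') θ : ℝ)} with hW
  set F := Finset.univ.filter fun j => D ≤ |(d j : ℝ)| with hF
  set A : Fin n → Set ℝ := fun j => {θ : ℝ | |Real.sin (2 * Real.pi * (d j * θ))| < r} with hA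
  have hEm : MeasurableSet E := measurableSet_medianSet d r s D
  have hWm : MeasurableSet W := measurableSet_le_nearCount d (r + r') s
  have hAm : ∀ j, MeasurableSet (A j) := fun j => measurableSet_near r (d j)
  set ℓ : ℝ := r' / (2 * Real.pi * D) with hℓ
  have hpi := Real.pi_pos
  have hℓ0 : 0 < ℓ := by positivity
  have hEW : ∀ θ τ, τ ∈ Set.Icc 0 ℓ → θ + τ ∈ E → θ ∈ W := by
    intro θ τ hτ h
    refine le_trans (b := ((Finset.univ.filter fun j =>
      |Real.sin (2 * Real.pi * (d j * (θ + τ)))| < r ∧ |(d j : ℝ)| ≤ D).card : ℝ)) h.1 ?_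
    unfold nearCount
    refine Nat.cast_le.2 (Finset.card_le_card fun j hj => ?_)
    simp only [Finset.mem_filter, Finset.mem_univ, true_and] at hj ⊢
    have e : 2 * Real.pi * (d j * θ) =
        2 * Real.pi * (d j * (θ + τ)) - 2 * Real.pi * (d j * τ) := by ring
    have h1 : |Real.sin (2 * Real.pi * (d j * τ))| ≤ r' := by
      refine Real.abs_sin_le_abs.trans ?_
      rw [abs_mul, abs_mul, abs_mul, abs_of_pos hpi, abs_two, abs_of_nonneg hτ.1]
      calc 2 * Real.pi * (|(d j : ℝ)| * τ) ≤ 2 * Real.pi * (D * ℓ) := by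
            have := hτ.1
            have := hτ.2
            have := hj.2
            gcongr
        _ = r' := by rw [hℓ]; field_simp
    rw [e, Real.sin_sub]
    refine (abs_sub _ _).trans_lt ?_
    rw [abs_mul, abs_mul]
    have h2 := Real.abs_cos_le_one (2 * Real.pi * (d j * τ))
    have h3 := Real.abs_cos_le_one (2 * Real.pi * (d j * (θ + τ)))
    have h4 := abs_nonneg (Real.sin (2 * Real.pi * (d j * (θ + τ))))
    have h5 := abs_nonneg (Real.sin (2 * Real.pi * (d j * τ)))
    nlinarith [hj.1]
  have hEX : ∀ θ, E.indicator (1 : ℝ → ℝ) θ ≤ 1 / s * ∑ j ∈ F, (A j).indicator 1 θ := by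
    intro θ
    by_cases hθ : θ ∈ E
    · rw [Set.indicator_of_mem hθ, Pi.one_apply, one_div_mul_eq_div, le_div_iff₀ hs, one_mul]
      refine le_trans hθ.2 ?_
      rw [Finset.card_filter, hF, Finset.sum_filter]
      push_cast
      refine Finset.sum_le_sum fun j _ => ?_
      split_ifs with h1 h2 h2
      · rw [Set.indicator_of_mem (show θ ∈ A j from h1.1), Pi.one_apply]
      · exact absurd h1.2 h2
      · exact Set.indicator_nonneg (by simp) _
      · exact le_rfl
    · rw [Set.indicator_of_notMem hθ]
      have : 0 ≤ ∑ j ∈ F, (A j).indicator (1 : ℝ → ℝ) θ :=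
        Finset.sum_nonneg fun i _ => Set.indicator_nonneg (by simp) _
      positivity
  have hinner : ∀ θ, ∫ τ in (0 : ℝ)..ℓ, E.indicator (1 : ℝ → ℝ) (θ + τ) ≤
      W.indicator (1 : ℝ → ℝ) θ * (n / s * (ℓ * r + r / (2 * D))) := by
    intro θ
    by_cases hθ : θ ∈ W
    · rw [Set.indicator_of_mem hθ, Pi.one_apply, one_mul,
        intervalIntegral.integral_comp_add_left (fun τ => E.indicator (1 : ℝ → ℝ) τ), add_zero]
      have hint : ∀ j ∈ F, IntervalIntegrable ((A j).indicator (1 : ℝ → ℝ)) volume θ (θ + ℓ) :=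
        fun j _ => intervalIntegrable_indicator (hAm j) _ _
      have h1 : ∫ τ in θ..θ + ℓ, E.indicator (1 : ℝ → ℝ) τ ≤
          ∫ τ in θ..θ + ℓ, 1 / s * ∑ j ∈ F, (A j).indicator 1 τ := by
        refine intervalIntegral.integral_mono_on (by linarith)
          (intervalIntegrable_indicator hEm _ _) ?_ fun x _ => hEX x
        simpa only [Finset.sum_apply] using (IntervalIntegrable.sum _ hint).const_mul (1 / s)
      refine h1.trans ?_
      rw [intervalIntegral.integral_const_mul, intervalIntegral.integral_finsetSum hint]
      have h2 : ∀ j ∈ F, ∫ τ in θ..θ + ℓ, (A j).indicator (1 : ℝ → ℝ) τ ≤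
          ℓ * r + r / (2 * D) := by
        intro j hj
        have hDj : D ≤ |(d j : ℝ)| := (Finset.mem_filter.1 hj).2
        have hdj : d j ≠ 0 := by
          intro h
          rw [h] at hDj
          simp only [Int.cast_zero, abs_zero] at hDj
          linarith
        refine (integral_near_le hdj hr hℓ0.le θ).trans ?_
        gcongr
      have h3 : (F.card : ℝ) ≤ n := by
        have := Finset.card_le_univ F
        rw [Fintype.card_fin] at this
        exact_mod_cast this
      calc 1 / s * ∑ j ∈ F, ∫ τ in θ..θ + ℓ, (A j).indicator (1 : ℝ → ℝ) τ
          ≤ 1 / s * (F.card * (ℓ * r + r / (2 * D))) := by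
            refine mul_le_mul_of_nonneg_left ?_ (by positivity)
            simpa only [nsmul_eq_mul] using Finset.sum_le_card_nsmul _ _ _ h2
        _ ≤ 1 / s * (n * (ℓ * r + r / (2 * D))) := by gcongr
        _ = n / s * (ℓ * r + r / (2 * D)) := by ring
    · rw [Set.indicator_of_notMem hθ, zero_mul]
      refine le_of_eq (intervalIntegral.integral_zero_ae
        (Filter.Eventually.of_forall fun τ hτ => Set.indicator_of_notMem ?_ _))
      rw [Set.uIoc_of_le hℓ0.le] at hτ
      exact fun h => hθ (hEW θ τ ⟨hτ.1.le, hτ.2⟩ h)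
  have hper : Function.Periodic (E.indicator (1 : ℝ → ℝ)) 1 := by
    intro x
    have : ∀ j, Real.sin (2 * Real.pi * (d j * (x + 1))) = Real.sin (2 * Real.pi * (d j * x)) := by
      intro j
      have e : 2 * Real.pi * (d j * (x + 1)) =
          2 * Real.pi * (d j * x) + d j * (2 * Real.pi) := by ring
      rw [e, Real.sin_add_int_mul_two_pi]
    simp only [Set.indicator_apply, hE, medianSet, Set.mem_inter_iff, Set.mem_ofPred_eq, this,
      Pi.one_apply]
  have hshift : ∀ τ : ℝ, ∫ θ in (0 : ℝ)..1, E.indicator (1 : ℝ → ℝ) (θ + τ) = freq E := by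
    intro τ
    rw [intervalIntegral.integral_comp_add_right (fun τ => E.indicator (1 : ℝ → ℝ) τ), add_comm 1 τ,
      zero_add, hper.intervalIntegral_add_eq τ 0, zero_add, freq]
  have hswap : ℓ * freq E = ∫ θ in (0 : ℝ)..1, ∫ τ in (0 : ℝ)..ℓ,
      E.indicator (1 : ℝ → ℝ) (θ + τ) := by
    rw [intervalIntegral_intervalIntegral_swap]
    · simp only [hshift, intervalIntegral.integral_const, sub_zero, smul_eq_mul]
    · refine Measure.integrableOn_of_bounded (M := 1) ?_ ?_ ?_
      · rw [Measure.volume_eq_prod, Measure.prod_prod]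
        exact ENNReal.mul_ne_top (by simp [Set.uIoc]) (by simp [Set.uIoc])
      · exact ((measurable_indicator_one hEm).comp
          (measurable_fst.add measurable_snd)).aestronglyMeasurable
      · exact Filter.Eventually.of_forall fun x => by
          simpa [Function.uncurry] using abs_indicator_one_le E (x.1 + x.2)
  have hfin : ℓ * freq E ≤ n / s * (ℓ * r + r / (2 * D)) * freq W := by
    rw [hswap, freq, ← intervalIntegral.integral_const_mul,
      intervalIntegral.integral_of_le zero_le_one, intervalIntegral.integral_of_le zero_le_one]
    refine integral_mono_of_nonneg (Filter.Eventually.of_forall fun θ =>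
      intervalIntegral.integral_nonneg hℓ0.le fun _ _ => Set.indicator_nonneg (by simp) _) ?_
      (Filter.Eventually.of_forall fun θ => ?_)
    · exact ((intervalIntegrable_indicator hWm 0 1).const_mul _).1
    · simpa only [mul_comm] using hinner θ
  have hc : n / s * (ℓ * r + r / (2 * D)) * freq W =
      ℓ * (n / s * (r + Real.pi * r / r') * freq W) := by
    have : r / (2 * D) = ℓ * (Real.pi * r / r') := by rw [hℓ]; field_simp
    rw [this]; ring
  rw [hc] at hfin
  exact le_of_mul_le_mul_left hfin hℓ0

/-- Passing from constant scale to scale `r` gains a factor `O(r)` in the measure of the frequencies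
at which a positive proportion of the coordinates is degenerate. -/
lemma freq_le_nearCount_le {n : ℕ} (d : Fin n → ℤ) (hd : ∀ j, d j ≠ 0) {r r' s : ℝ}
    (hr : 0 ≤ r) (hr' : 0 < r') (hs : 0 < s) :
    freq {θ | 3 * s ≤ (nearCount d r θ : ℝ)} ≤
      (n / s) ^ 2 * (r + Real.pi * r / r') *
        freq {θ | s ≤ (nearCount d (r + r') θ : ℝ)} := by
  have hsub : ∀ θ, {θ | 3 * s ≤ (nearCount d r θ : ℝ)}.indicator (1 : ℝ → ℝ) θ ≤
      1 / s * ∑ i, (medianSet d r s |(d i : ℝ)|).indicator (1 : ℝ → ℝ) θ := by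
    intro θ
    by_cases hθ : θ ∈ {θ | 3 * s ≤ (nearCount d r θ : ℝ)}
    · rw [Set.indicator_of_mem hθ, Pi.one_apply, one_div_mul_eq_div, le_div_iff₀ hs, one_mul]
      have := le_card_medians (Finset.univ.filter fun j =>
        |Real.sin (2 * Real.pi * (d j * θ))| < r) (fun j => |(d j : ℝ)|) hs hθ
      refine this.trans ?_
      simp only [Finset.filter_filter]
      rw [Finset.card_filter]
      push_cast
      refine Finset.sum_le_sum fun i _ => ?_
      split_ifs with h
      · rw [Set.indicator_of_mem, Pi.one_apply]
        exact h.2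
      · exact Set.indicator_nonneg (by simp) _
    · rw [Set.indicator_of_notMem hθ]
      have : 0 ≤ ∑ i, (medianSet d r s |(d i : ℝ)|).indicator (1 : ℝ → ℝ) θ :=
        Finset.sum_nonneg fun i _ => Set.indicator_nonneg (by simp) _
      positivity
  have hint : ∀ i ∈ Finset.univ, IntervalIntegrable
      ((medianSet d r s |(d i : ℝ)|).indicator (1 : ℝ → ℝ)) volume 0 1 := fun i _ =>
    intervalIntegrable_indicator (measurableSet_medianSet _ _ _ _) _ _
  have h1 : freq {θ | 3 * s ≤ (nearCount d r θ : ℝ)} ≤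
      1 / s * ∑ i, freq (medianSet d r s |(d i : ℝ)|) := by
    unfold freq
    rw [← intervalIntegral.integral_finsetSum hint, ← intervalIntegral.integral_const_mul]
    refine intervalIntegral.integral_mono_on zero_le_one
      (intervalIntegrable_indicator (measurableSet_le_nearCount _ _ _) _ _) ?_
      fun x _ => hsub x
    simpa only [Finset.sum_apply] using (IntervalIntegrable.sum _ hint).const_mul (1 / s)
  have h2 : ∑ i, freq (medianSet d r s |(d i : ℝ)|) ≤ ∑ _i : Fin n, n / s *
      (r + Real.pi * r / r') * freq {θ | s ≤ (nearCount d (r + r') θ : ℝ)} :=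
    Finset.sum_le_sum fun i _ => freq_medianSet_le d hr hr' hs
      (abs_pos.2 (by exact_mod_cast hd i))
  refine h1.trans ((mul_le_mul_of_nonneg_left h2 (by positivity)).trans_eq ?_)
  rw [Finset.sum_const, Finset.card_univ, Fintype.card_fin, nsmul_eq_mul]
  field_simp

/-! ### Moments of exponential sums -/

lemma integral_e_int_mul (c : ℤ) :
    ∫ θ in (0 : ℝ)..1, e (c * θ) = if c = 0 then 1 else 0 := by
  split_ifs with h
  · simp [h]
  · have hc : (2 * Real.pi * c * Complex.I : ℂ) ≠ 0 := by
      simp [Real.pi_ne_zero, h]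
    have e1 : ∀ θ : ℝ, e (c * θ) = Complex.exp (2 * Real.pi * c * Complex.I * θ) := by
      intro θ; rw [e]; push_cast; ring_nf
    simp only [e1]
    rw [integral_exp_mul_complex hc]
    have e2 : Complex.exp (2 * Real.pi * c * Complex.I * (1 : ℝ)) = 1 := by
      rw [← Complex.exp_int_mul_two_pi_mul_I c]; push_cast; ring_nf
    rw [e2]
    simp

lemma norm_sum_e_sq {ι : Type*} [Fintype ι] (c : ι → ℤ) (θ : ℝ) :
    ((‖∑ i, e (c i * θ)‖ ^ 2 : ℝ) : ℂ) = ∑ i, ∑ i', e (((c i - c i' : ℤ) : ℝ) * θ) := by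
  have := Complex.mul_conj (∑ i, e (c i * θ))
  rw [Complex.normSq_eq_norm_sq] at this
  rw [← this, map_sum, Finset.sum_mul_sum]
  refine Finset.sum_congr rfl fun i _ => Finset.sum_congr rfl fun i' _ => ?_
  rw [conj_e, ← e_add]
  push_cast
  ring_nf

/-- Parseval's identity for exponential sums with integer frequencies. -/
lemma integral_norm_sum_e_sq {ι : Type*} [Fintype ι] (c : ι → ℤ) :
    ∫ θ in (0 : ℝ)..1, ‖∑ i, e (c i * θ)‖ ^ 2 =
      (Finset.univ.filter fun p : ι × ι => c p.1 = c p.2).card := by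
  apply Complex.ofReal_injective
  rw [← intervalIntegral.integral_ofReal]
  simp only [norm_sum_e_sq]
  have hI : ∀ i i', IntervalIntegrable (fun θ : ℝ => e (((c i - c i' : ℤ) : ℝ) * θ)) volume 0 1 :=
    fun i i' => (continuous_e.comp (by fun_prop)).intervalIntegrable _ _
  have hI2 : ∀ i, IntervalIntegrable
      (fun θ : ℝ => ∑ i', e (((c i - c i' : ℤ) : ℝ) * θ)) volume 0 1 := fun i =>
    (continuous_finsetSum _ fun i' _ => continuous_e.comp (by fun_prop)).intervalIntegrable _ _
  rw [intervalIntegral.integral_finsetSum fun i _ => hI2 i]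
  simp_rw [intervalIntegral.integral_finsetSum fun i' _ => hI _ i', integral_e_int_mul, sub_eq_zero]
  rw [← Finset.sum_product', Finset.card_filter, Finset.univ_product_univ]
  push_cast
  exact Finset.sum_congr rfl fun p _ => by split_ifs <;> simp

lemma integral_norm_sum_e_sq_le_of_injective {n : ℕ} {d : Fin n → ℤ}
    (hd : Function.Injective d) {k : ℤ} (hk : k ≠ 0) :
    ∫ θ in (0 : ℝ)..1, ‖∑ j, e (((k * d j : ℤ) : ℝ) * θ)‖ ^ 2 ≤ n := by
  rw [integral_norm_sum_e_sq]
  have : (Finset.univ.filter fun p : Fin n × Fin n => k * d p.1 = k * d p.2) ⊆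
      Finset.univ.image fun j => (j, j) := by
    intro p hp
    simp only [Finset.mem_filter, Finset.mem_univ, true_and, mul_eq_mul_left_iff, hk, or_false,
      Finset.mem_image] at hp ⊢
    exact ⟨p.1, Prod.ext rfl (hd hp)⟩
  have h2 := (Finset.card_le_card this).trans Finset.card_image_le
  rw [Finset.card_univ, Fintype.card_fin] at h2
  exact_mod_cast h2

lemma integral_norm_sum_e_pow_four_le {n : ℕ} {d : Fin n → ℤ}
    (hd : Function.Injective d) (hS : IsWeakSidon (Finset.univ.image d)) {k : ℤ} (hk : k ≠ 0) :
    ∫ θ in (0 : ℝ)..1, ‖∑ j, e (((k * d j : ℤ) : ℝ) * θ)‖ ^ 4 ≤ 100 * (n : ℝ) ^ 2 := by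
  have h1 : ∀ θ : ℝ, ‖∑ j, e (((k * d j : ℤ) : ℝ) * θ)‖ ^ 4 =
      ‖∑ p : Fin n × Fin n, e (((k * (d p.1 + d p.2) : ℤ) : ℝ) * θ)‖ ^ 2 := by
    intro θ
    have : ∑ p : Fin n × Fin n, e (((k * (d p.1 + d p.2) : ℤ) : ℝ) * θ) =
        (∑ j, e (((k * d j : ℤ) : ℝ) * θ)) ^ 2 := by
      rw [sq, Finset.sum_mul_sum, ← Finset.sum_product']
      refine Finset.sum_congr rfl fun p _ => ?_
      rw [← e_add]
      push_cast
      ring_nf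
    rw [this, norm_pow, ← pow_mul]
  simp only [h1]
  rw [integral_norm_sum_e_sq]
  have hcard : (Finset.univ.image d).card = n := by
    rw [Finset.card_image_of_injective _ hd, Finset.card_univ, Fintype.card_fin]
  have h2 : (Finset.univ.filter fun p : (Fin n × Fin n) × (Fin n × Fin n) =>
      k * (d p.1.1 + d p.1.2) = k * (d p.2.1 + d p.2.2)).card ≤
      (sidonSolutions (Finset.univ.image d)).card := by
    refine Finset.card_le_card_of_injOn
      (fun p => (fun _ => 1, ![d p.1.1, d p.1.2, d p.2.1, d p.2.2])) ?_ ?_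
    · intro p hp
      simp only [Finset.coe_filter, Finset.mem_univ, true_and, Set.mem_ofPred_eq,
        mul_eq_mul_left_iff, hk, or_false] at hp
      simp [sidonSolutions, signCube, Fin.forall_fin_succ, hp]
    · rintro ⟨⟨a, b⟩, c, f⟩ _ ⟨⟨a', b'⟩, c', f'⟩ _ h
      simp only [Prod.mk.injEq, true_and] at h
      have h0 := congrFun h 0
      have h1 := congrFun h 1
      have h2 := congrFun h 2
      have h3 := congrFun h 3
      simp at h0 h1 h2 h3
      rw [hd h0, hd h1, hd h2, hd h3]
  unfold IsWeakSidon at hS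
  rw [hcard] at hS
  exact_mod_cast h2.trans hS

lemma norm_e_nat_mul_sub_one_le (a : ℕ) (t : ℝ) : ‖e (a * t) - 1‖ ≤ a * ‖e t - 1‖ := by
  induction a with
  | zero => simp
  | succ a ih =>
    have : e ((a + 1 : ℕ) * t) - 1 = e t * (e (a * t) - 1) + (e t - 1) := by
      have : ((a + 1 : ℕ) : ℝ) * t = t + a * t := by push_cast; ring
      rw [this, e_add]; ring
    rw [this]
    refine (norm_add_le _ _).trans ?_
    rw [norm_mul, norm_e, one_mul]
    push_cast
    linarith

/-- If many of the `e (2 d_j θ)` are near `1`, then one of the exponential sums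
`∑ j, e (2 k d_j θ)` with `0 < |k| < M` is large. The squares `|∑ a < M, e (2 a d_j θ)|²` are
nonnegative (a Fejér kernel), so the remaining `j` cannot cancel this contribution. -/
lemma exists_large_sum {n M : ℕ} (d : Fin n → ℤ) {r s θ : ℝ} (hs : 0 < s)
    (hM : 4 * n ≤ M * s) (hM0 : 0 < M) (hr : 8 * M * r ≤ 1) (hθ : s ≤ nearCount d r θ) :
    ∃ p ∈ (Finset.range M).offDiag,
      s / 4 ≤ ‖∑ j, e (((2 * ((p.1 : ℤ) - p.2) * d j : ℤ) : ℝ) * θ)‖ := by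
  by_contra! H
  have hMr : (0 : ℝ) < M := by exact_mod_cast hM0
  set Q : Fin n → ℂ := fun j => ∑ a ∈ Finset.range M, e (a * (2 * (d j * θ))) with hQ
  have hnear : ∀ j ∈ Finset.univ.filter fun j => |Real.sin (2 * Real.pi * (d j * θ))| < r,
      9 / 16 * (M : ℝ) ^ 2 ≤ ‖Q j‖ ^ 2 := by
    intro j hj
    have hj' : |Real.sin (2 * Real.pi * (d j * θ))| < r := (Finset.mem_filter.1 hj).2
    have h1 : ‖e (2 * (d j * θ)) - 1‖ ≤ 2 * r := by
      rw [norm_e_sub_one]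
      have : Real.pi * (2 * (d j * θ)) = 2 * Real.pi * (d j * θ) := by ring
      rw [this]; linarith
    have h2 : ‖Q j - M‖ ≤ M / 4 := by
      have : Q j - M = ∑ a ∈ Finset.range M, (e (a * (2 * (d j * θ))) - 1) := by
        rw [Finset.sum_sub_distrib]; simp [hQ]
      rw [this]
      refine (norm_sum_le _ _).trans ?_
      have : ∀ a ∈ Finset.range M, ‖e (a * (2 * (d j * θ))) - 1‖ ≤ 1 / 4 := by
        intro a ha
        have ha' : (a : ℝ) ≤ M := by exact_mod_cast (Finset.mem_range.1 ha).le
        refine (norm_e_nat_mul_sub_one_le _ _).trans ?_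
        calc (a : ℝ) * ‖e (2 * (d j * θ)) - 1‖ ≤ M * (2 * r) := by gcongr
          _ ≤ 1 / 4 := by linarith
      refine (Finset.sum_le_card_nsmul _ _ _ this).trans_eq ?_
      rw [Finset.card_range, nsmul_eq_mul]; ring
    have h3 : (M : ℝ) - ‖Q j‖ ≤ M / 4 := by
      have := norm_sub_norm_le (M : ℂ) (Q j)
      rw [Complex.norm_natCast, norm_sub_rev] at this
      linarith
    nlinarith
  -- Double counting `∑ j, ‖Q j‖ ^ 2`: the degenerate `j` alone give more than the diagonal terms
  -- and the small sums `∑ j, e (2 (a - b) d_j θ)` can.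
  have hlow : s * (9 / 16 * (M : ℝ) ^ 2) ≤ ∑ j, ‖Q j‖ ^ 2 := by
    calc s * (9 / 16 * (M : ℝ) ^ 2) ≤ nearCount d r θ * (9 / 16 * (M : ℝ) ^ 2) := by gcongr
      _ ≤ ∑ j ∈ Finset.univ.filter fun j => |Real.sin (2 * Real.pi * (d j * θ))| < r,
          ‖Q j‖ ^ 2 := by
        rw [← nsmul_eq_mul]
        exact Finset.card_nsmul_le_sum _ _ _ hnear
      _ ≤ _ := Finset.sum_le_sum_of_subset_of_nonneg (Finset.subset_univ _)
          fun _ _ _ => by positivity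
  have hexp : ((∑ j, ‖Q j‖ ^ 2 : ℝ) : ℂ) = ∑ p ∈ Finset.range M ×ˢ Finset.range M,
      ∑ j, e (((2 * ((p.1 : ℤ) - p.2) * d j : ℤ) : ℝ) * θ) := by
    rw [Finset.sum_comm, Complex.ofReal_sum]
    refine Finset.sum_congr rfl fun j _ => ?_
    have := Complex.mul_conj (Q j)
    rw [Complex.normSq_eq_norm_sq] at this
    rw [← this, hQ, map_sum, Finset.sum_mul_sum, Finset.sum_product]
    refine Finset.sum_congr rfl fun a _ => Finset.sum_congr rfl fun b _ => ?_
    rw [conj_e, ← e_add]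
    push_cast
    ring_nf
  have hup : ∑ j, ‖Q j‖ ^ 2 ≤ n * M + (M : ℝ) ^ 2 * (s / 4) := by
    have h0 : 0 ≤ ∑ j, ‖Q j‖ ^ 2 := by positivity
    rw [← abs_of_nonneg h0, ← Real.norm_eq_abs, ← Complex.norm_real, hexp,
      ← Finset.diag_union_offDiag, Finset.sum_union (Finset.disjoint_diag_offDiag _)]
    refine (norm_add_le _ _).trans (add_le_add ?_ ?_)
    · refine (norm_sum_le_of_le _ (f := _) (n := fun _ => (n : ℝ)) ?_).trans_eq ?_
      · intro p hp
        have := (Finset.mem_diag.1 hp).2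
        simp [this]
      · rw [Finset.sum_const, Finset.diag_card, Finset.card_range, nsmul_eq_mul, mul_comm]
    · refine (norm_sum_le_of_le _ (f := _) (n := fun _ => s / 4) fun p hp => (H p hp).le).trans ?_
      rw [Finset.sum_const, Finset.offDiag_card, Finset.card_range, nsmul_eq_mul]
      have : ((M * M - M : ℕ) : ℝ) ≤ (M : ℝ) ^ 2 := by
        rw [sq]; exact_mod_cast Nat.sub_le _ _
      gcongr
  have : (n : ℝ) * M ≤ M * s / 4 * M := by gcongr; linarith
  nlinarith [mul_pos hs (pow_pos hMr 2)]

/-- A moment bound for the exponential sums `∑ j, e (k d_j θ)` bounds the proportion of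
frequencies at which many coordinates are degenerate. -/
lemma freq_le_nearCount_le_of_moment {n M h : ℕ} (d : Fin n → ℤ) {r s m : ℝ} (hs : 0 < s)
    (hM : 4 * n ≤ M * s) (hM0 : 0 < M) (hr : 8 * M * r ≤ 1)
    (hm : ∀ k : ℤ, k ≠ 0 → ∫ θ in (0 : ℝ)..1, ‖∑ j, e (((k * d j : ℤ) : ℝ) * θ)‖ ^ h ≤ m) :
    freq {θ | s ≤ (nearCount d r θ : ℝ)} ≤ (M : ℝ) ^ 2 * (m / (s / 4) ^ h) := by
  set S : ℕ × ℕ → ℝ → ℂ := fun p θ =>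
    ∑ j, e (((2 * ((p.1 : ℤ) - p.2) * d j : ℤ) : ℝ) * θ) with hS
  have hScont : ∀ p, Continuous (S p) := fun p =>
    continuous_finsetSum _ fun i' _ => continuous_e.comp (by fun_prop)
  have hint : ∀ p ∈ (Finset.range M).offDiag,
      IntervalIntegrable (fun θ => ‖S p θ‖ ^ h / (s / 4) ^ h) volume 0 1 := fun p _ =>
    (((hScont p).norm.pow h).div_const _).intervalIntegrable _ _
  have hpt : ∀ θ, {θ | s ≤ (nearCount d r θ : ℝ)}.indicator (1 : ℝ → ℝ) θ ≤
      ∑ p ∈ (Finset.range M).offDiag, ‖S p θ‖ ^ h / (s / 4) ^ h := by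
    intro θ
    have hnn : ∀ p ∈ (Finset.range M).offDiag, 0 ≤ ‖S p θ‖ ^ h / (s / 4) ^ h := fun p _ => by
      positivity
    by_cases hθ : θ ∈ {θ | s ≤ (nearCount d r θ : ℝ)}
    · rw [Set.indicator_of_mem hθ, Pi.one_apply]
      obtain ⟨p, hp, hle⟩ := exists_large_sum d hs hM hM0 hr hθ
      refine le_trans ?_ (Finset.single_le_sum hnn hp)
      rw [le_div_iff₀ (by positivity), one_mul]
      exact pow_le_pow_left₀ (by positivity) hle h
    · rw [Set.indicator_of_notMem hθ]
      exact Finset.sum_nonneg hnn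
  have h1 : freq {θ | s ≤ (nearCount d r θ : ℝ)} ≤
      ∑ p ∈ (Finset.range M).offDiag, ∫ θ in (0 : ℝ)..1, ‖S p θ‖ ^ h / (s / 4) ^ h := by
    unfold freq
    rw [← intervalIntegral.integral_finsetSum hint]
    refine intervalIntegral.integral_mono_on zero_le_one
      (intervalIntegrable_indicator (measurableSet_le_nearCount _ _ _) _ _) ?_ fun x _ => hpt x
    exact (continuous_finsetSum _ fun p _ =>
      ((hScont p).norm.pow h).div_const _).intervalIntegrable _ _
  have hm0 : 0 ≤ m := le_trans
    (intervalIntegral.integral_nonneg zero_le_one fun _ _ => by positivity) (hm 1 one_ne_zero)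
  refine h1.trans ((Finset.sum_le_card_nsmul _ _ (m / (s / 4) ^ h) fun p hp => ?_).trans ?_)
  · rw [intervalIntegral.integral_div]
    refine div_le_div_of_nonneg_right (hm _ ?_) (by positivity)
    have := (Finset.mem_offDiag.1 hp).2.2
    omega
  · rw [Finset.offDiag_card, Finset.card_range, nsmul_eq_mul]
    have : ((M * M - M : ℕ) : ℝ) ≤ (M : ℝ) ^ 2 := by
      rw [sq]; exact_mod_cast Nat.sub_le _ _
    gcongr

/-! ### Fourier inversion and the count of bad directions -/

lemma continuous_charFun {n : ℕ} (B : Finset (Fin n → ℤ)) (x : Fin n → ℤ) :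
    Continuous (charFun B x) :=
  (continuous_finsetSum _ fun _ _ => continuous_e.comp (by fun_prop)).div_const _

lemma norm_charFun_le_one {n : ℕ} (B : Finset (Fin n → ℤ)) (x : Fin n → ℤ) (θ : ℝ) :
    ‖charFun B x θ‖ ≤ 1 := by
  rw [charFun, norm_div, Complex.norm_natCast]
  refine div_le_one_of_le₀ ((norm_sum_le _ _).trans ?_) (by positivity)
  simp

lemma prob_eq_integral {n : ℕ} (B : Finset (Fin n → ℤ)) (x : Fin n → ℤ) (k : ℤ) :
    (prob B x k : ℂ) = ∫ θ in (0 : ℝ)..1, charFun B x θ * e (((-k : ℤ) : ℝ) * θ) := by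
  have h1 : ∀ θ : ℝ, charFun B x θ * e (((-k : ℤ) : ℝ) * θ) =
      (∑ y ∈ B, e ((((∑ j, x j * y j) - k : ℤ) : ℝ) * θ)) / (B.card : ℂ) := by
    intro θ
    rw [charFun, div_mul_eq_mul_div, Finset.sum_mul]
    congr 1
    refine Finset.sum_congr rfl fun y _ => ?_
    rw [← e_add]
    push_cast
    ring_nf
  simp only [h1]
  rw [intervalIntegral.integral_div, intervalIntegral.integral_finsetSum]
  · simp only [integral_e_int_mul, sub_eq_zero, prob, Finset.card_filter]
    push_cast
    refine congrArg (· / (B.card : ℂ)) (Finset.sum_congr rfl fun y _ => ?_)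
    split_ifs <;> simp
  · exact fun y _ => (continuous_e.comp (by fun_prop)).intervalIntegrable _ _

lemma prob_le_integral_norm {n : ℕ} (B : Finset (Fin n → ℤ)) (x : Fin n → ℤ) (k : ℤ) :
    prob B x k ≤ ∫ θ in (0 : ℝ)..1, ‖charFun B x θ‖ := by
  have h := intervalIntegral.norm_integral_le_integral_norm (μ := volume) zero_le_one
    (f := fun θ : ℝ => charFun B x θ * e (((-k : ℤ) : ℝ) * θ))
  rw [← prob_eq_integral, Complex.norm_real] at h
  simp only [norm_mul, norm_e, mul_one] at h
  exact (Real.le_norm_self _).trans h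

lemma prob_le_one {n : ℕ} (B : Finset (Fin n → ℤ)) (x : Fin n → ℤ) (k : ℤ) : prob B x k ≤ 1 :=
  div_le_one_of_le₀ (by exact_mod_cast Finset.card_filter_le _ _) (by positivity)

lemma badDirections_anti {n : ℕ} (A B : Finset (Fin n → ℤ)) {t t' : ℝ} (h : t ≤ t') :
    badDirections A B t' ⊆ badDirections A B t := by
  classical
  intro x hx
  simp only [badDirections, Finset.mem_filter] at hx ⊢
  exact ⟨hx.1, fun H => hx.2 fun k => (H k).trans h⟩

lemma badDirections_eq_empty {n : ℕ} (A B : Finset (Fin n → ℤ)) {t : ℝ} (h : 1 ≤ t) :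
    badDirections A B t = ∅ := by
  classical
  simp only [badDirections, Finset.filter_eq_empty_iff, not_not]
  exact fun x _ k => (prob_le_one B x k).trans h

/-- If outside the set `E` of frequencies the `q`-th moments of the characteristic functions over
`x ∈ A` sum to at most `R`, then few directions can exceed the threshold `freq E + t`. -/
lemma card_badDirections_mul_pow_le {n : ℕ} (A B : Finset (Fin n → ℤ)) {E : Set ℝ}
    (hE : MeasurableSet E) {q : ℕ} (hq : q ≠ 0) {t R : ℝ} (ht : 0 ≤ t) (hR : 0 ≤ R)
    (H : ∀ θ ∉ E, ∑ x ∈ A, ‖charFun B x θ‖ ^ q ≤ R) :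
    (badDirections A B (freq E + t)).card * t ^ q ≤ R := by
  classical
  set f : (Fin n → ℤ) → ℝ → ℝ := fun x θ => Eᶜ.indicator (1 : ℝ → ℝ) θ * ‖charFun B x θ‖ with hf
  have hf0 : ∀ x θ, 0 ≤ f x θ := fun x θ =>
    mul_nonneg (Set.indicator_nonneg (by simp) _) (norm_nonneg _)
  have hf1 : ∀ x θ, f x θ ≤ 1 := fun x θ =>
    mul_le_one₀ ((le_abs_self _).trans (abs_indicator_one_le _ _)) (norm_nonneg _)
      (norm_charFun_le_one _ _ _)
  have hfm : ∀ x, Measurable (f x) := fun x =>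
    (measurable_indicator_one hE.compl).mul (continuous_charFun B x).norm.measurable
  have hfi : ∀ x, IntervalIntegrable (f x) volume 0 1 := fun x =>
    intervalIntegrable_of_bounded (hfm x) (C := 1)
      (fun θ => by rw [abs_of_nonneg (hf0 x θ)]; exact hf1 x θ) _ _
  have hfqi : ∀ x, IntervalIntegrable (fun θ => f x θ ^ q) volume 0 1 := fun x =>
    intervalIntegrable_of_bounded ((hfm x).pow_const q) (C := 1)
      (fun θ => by rw [abs_of_nonneg (pow_nonneg (hf0 x θ) _)]
                   exact pow_le_one₀ (hf0 x θ) (hf1 x θ)) _ _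
  have hbad : ∀ x ∈ badDirections A B (freq E + t), t ^ q ≤ ∫ θ in (0 : ℝ)..1, f x θ ^ q := by
    intro x hx
    have hx' := (Finset.mem_filter.1 hx).2
    push Not at hx'
    obtain ⟨k, hk⟩ := hx'
    have h1 : ∫ θ in (0 : ℝ)..1, ‖charFun B x θ‖ ≤ freq E + ∫ θ in (0 : ℝ)..1, f x θ := by
      rw [freq, ← intervalIntegral.integral_add (intervalIntegrable_indicator hE 0 1) (hfi x)]
      refine intervalIntegral.integral_mono_on zero_le_one
        ((continuous_charFun B x).norm.intervalIntegrable _ _)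
        ((intervalIntegrable_indicator hE 0 1).add (hfi x)) fun θ _ => ?_
      by_cases hθ : θ ∈ E
      · simpa [hf, hθ] using norm_charFun_le_one B x θ
      · simp [hf, hθ]
    have h2 : t ≤ ∫ θ in (0 : ℝ)..1, f x θ := by
      linarith [prob_le_integral_norm B x k]
    refine (pow_le_pow_left₀ ht h2 q).trans ?_
    rw [intervalIntegral.integral_of_le zero_le_one, intervalIntegral.integral_of_le zero_le_one]
    -- Jensen's inequality on `[0, 1]`.
    have : IsProbabilityMeasure (volume.restrict (Set.Ioc (0 : ℝ) 1)) :=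
      ⟨by simp⟩
    exact (convexOn_pow q).map_integral_le (continuousOn_pow q) isClosed_Ici
      (Filter.Eventually.of_forall fun θ => hf0 x θ) (hfi x).1 (hfqi x).1
  have hpt : ∀ θ, ∑ x ∈ badDirections A B (freq E + t), f x θ ^ q ≤ R := by
    intro θ
    by_cases hθ : θ ∈ E
    · simpa [hf, hθ, zero_pow hq] using hR
    · refine le_trans ?_ (H θ hθ)
      simp only [hf, Set.indicator_of_mem (show θ ∈ Eᶜ from hθ), Pi.one_apply, one_mul]
      exact Finset.sum_le_sum_of_subset_of_nonneg (Finset.filter_subset _ _)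
        fun _ _ _ => by positivity
  calc (badDirections A B (freq E + t)).card * t ^ q
      ≤ ∑ x ∈ badDirections A B (freq E + t), ∫ θ in (0 : ℝ)..1, f x θ ^ q := by
        rw [← nsmul_eq_mul]
        exact Finset.card_nsmul_le_sum _ _ _ hbad
    _ = ∫ θ in (0 : ℝ)..1, ∑ x ∈ badDirections A B (freq E + t), f x θ ^ q :=
        (intervalIntegral.integral_finsetSum fun x _ => hfqi x).symm
    _ ≤ ∫ _θ in (0 : ℝ)..1, R := by
        refine intervalIntegral.integral_mono_on zero_le_one ?_ (by simp) fun θ _ => hpt θ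
        simpa only [Finset.sum_fn] using
          IntervalIntegrable.sum (badDirections A B (freq E + t)) fun x _ => hfqi x
    _ = R := by simp

lemma freq_mono {A B : Set ℝ} (hA : MeasurableSet A) (hB : MeasurableSet B) (h : A ⊆ B) :
    freq A ≤ freq B :=
  intervalIntegral.integral_mono_on zero_le_one (intervalIntegrable_indicator hA 0 1)
    (intervalIntegrable_indicator hB 0 1) fun θ _ =>
      Set.indicator_le_indicator_of_subset h (fun _ => by simp) θ

lemma nearCount_mono {n : ℕ} (d : Fin n → ℤ) {r r' : ℝ} (h : r ≤ r') (θ : ℝ) :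
    nearCount d r θ ≤ nearCount d r' θ :=
  Finset.card_le_card (Finset.monotone_filter_right _ fun _ _ hj => lt_of_lt_of_le hj h)

/-! ### Choice of the parameters -/

lemma exists_log_le {c : ℝ} (hc : 0 < c) :
    ∃ N : ℕ, ∀ n : ℕ, N ≤ n → Real.log n ≤ c * n := by
  have h := Real.isLittleO_log_id_atTop.def hc
  have h2 := (tendsto_natCast_atTop_atTop (R := ℝ)).eventually h
  obtain ⟨N, hN⟩ := Filter.eventually_atTop.1 h2
  refine ⟨N, fun n hn => (le_abs_self _).trans ?_⟩
  simpa using hN n hn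

lemma one_div_le_two_mul_sqrt {n : ℕ} (hn : 2 ≤ n) :
    1 / (n : ℝ) ≤ 2 * Real.sqrt (Real.log n / n) := by
  have hn' : (2 : ℝ) ≤ n := by exact_mod_cast hn
  have hlog : (1 : ℝ) / 4 ≤ Real.log n := by
    have := Real.log_le_log (by norm_num) hn'
    linarith [Real.log_two_gt_d9]
  have : 1 / (2 * (n : ℝ)) ≤ Real.sqrt (Real.log n / n) := by
    apply Real.le_sqrt_of_sq_le
    rw [div_pow, one_pow, div_le_div_iff₀ (by positivity) (by positivity)]
    nlinarith [mul_le_mul_of_nonneg_right hlog (sq_nonneg (n : ℝ))]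
  have e : 1 / (n : ℝ) = 2 * (1 / (2 * (n : ℝ))) := by field_simp
  rw [e]
  linarith

/-- The anti-concentration bound for large `n`, in terms of a bound `a` for the proportion of
frequencies at which a fixed fraction of the coordinates is degenerate at constant scale. -/
lemma exists_card_badDirections_le {δ : ℝ} (hδ : 0 < δ) :
    ∃ (M N : ℕ) (C : ℝ), 0 < M ∧ 36 / δ ≤ M ∧ 0 < C ∧
      ∀ (n : ℕ), N ≤ n → 2 ≤ n → ∀ (u v : Fin n → ℤ), (∀ j, u j ≠ v j) →
      ∀ (β : ℝ) (B : Finset (Fin n → ℤ)), B ⊆ signCube n →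
        (B.card : ℝ) = (2 : ℝ) ^ (β * (n : ℝ)) →
      ∀ a : ℝ, 1 / (n : ℝ) ^ 2 ≤ a →
        freq {θ | δ * n / 9 ≤ (nearCount (fun j => u j - v j) (1 / (8 * M)) θ : ℝ)} ≤ a →
        ((badDirections (twoCube u v) B
          (C * a * Real.sqrt (Real.log n / n))).card : ℝ) ≤
            (2 : ℝ) ^ ((n : ℝ) * (1 - β + δ)) := by
  have hlog2 : 0 < Real.log 2 := Real.log_pos (by norm_num)
  set ε : ℝ := 2 ^ (δ / 3) - 1 with hε
  have hε0 : 0 < ε := by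
    have := Real.one_lt_rpow (show (1 : ℝ) < 2 by norm_num) (show 0 < δ / 3 by positivity)
    linarith
  obtain ⟨K, hK, HK⟩ := exists_moment_bound hε0
  -- `c` is such that `n⁻³` raised to the power `-K / r ^ 2 = -K n / (c log n)` is `2 ^ (δ n / 6)`.
  set c : ℝ := 18 * K / (δ * Real.log 2) with hc
  have hc0 : 0 < c := by positivity
  -- With `s = δ n / 9` below, `M` is the length of the Fejér kernel for which `4 n ≤ M s`, and
  -- `1 / (8 M)` is the constant scale that it resolves.
  set M : ℕ := ⌈36 / δ⌉₊ with hM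
  have hM0 : 0 < M := Nat.ceil_pos.2 (by positivity)
  have hM36 : 36 / δ ≤ M := Nat.le_ceil _
  have hMr : (0 : ℝ) < M := by exact_mod_cast hM0
  obtain ⟨N₁, hN₁⟩ := exists_log_le (c := δ * Real.log 2 / 36) (by positivity)
  obtain ⟨N₂, hN₂⟩ := exists_log_le (c := (1 / (16 * M)) ^ 2 / c) (by positivity)
  set C : ℝ := (9 / δ) ^ 2 * (1 + 16 * M * Real.pi) * Real.sqrt c + 2 with hC
  have hpi := Real.pi_pos
  refine ⟨M, max N₁ N₂, C, hM0, hM36, by positivity, ?_⟩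
  intro n hnN hn u v huv β B hB hBc a ha hW
  have hn' : (2 : ℝ) ≤ n := by exact_mod_cast hn
  have hn0 : (0 : ℝ) < n := by linarith
  have hlogn : 0 < Real.log n := Real.log_pos (by linarith)
  have hl1 := hN₁ n ((le_max_left _ _).trans hnN)
  have hl2 := hN₂ n ((le_max_right _ _).trans hnN)
  set L : ℝ := Real.sqrt (Real.log n / n) with hL
  have hL0 : 0 < L := Real.sqrt_pos.2 (by positivity)
  have hLsq : L ^ 2 = Real.log n / n := Real.sq_sqrt (by positivity)
  set r : ℝ := Real.sqrt c * L with hr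
  have hr0 : 0 < r := by positivity
  have hrsq : r ^ 2 = c * (Real.log n / n) := by
    rw [hr, mul_pow, Real.sq_sqrt hc0.le, hLsq]
  have hr1 : r ≤ 1 / (16 * M) := by
    apply le_of_sq_le_sq _ (by positivity)
    rw [hrsq, ← mul_div_assoc, div_le_iff₀ hn0]
    rw [div_mul_eq_mul_div, le_div_iff₀ hc0] at hl2
    linarith
  set d : Fin n → ℤ := fun j => u j - v j with hd
  have hd0 : ∀ j, d j ≠ 0 := fun j => sub_ne_zero.2 (huv j)
  set s : ℝ := δ * n / 9 with hs
  have hs0 : 0 < s := by positivity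
  set E : Set ℝ := {θ | 3 * s ≤ (nearCount d r θ : ℝ)} with hE
  have hEm : MeasurableSet E := measurableSet_le_nearCount d r (3 * s)
  have ha0 : 0 ≤ a := le_trans (by positivity) ha
  have hEa : freq E ≤ (9 / δ) ^ 2 * (1 + 16 * M * Real.pi) * Real.sqrt c * a * L := by
    have h1 := freq_le_nearCount_le d hd0 hr0.le (r' := 1 / (16 * M)) (by positivity) hs0
    have h2 : freq {θ | s ≤ (nearCount d (r + 1 / (16 * M)) θ : ℝ)} ≤ a := by
      refine le_trans (freq_mono (measurableSet_le_nearCount _ _ _)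
        (measurableSet_le_nearCount _ _ _) fun θ hθ => ?_) hW
      have h3 : r + 1 / (16 * M) ≤ 1 / (8 * M) := by
        have : (1 : ℝ) / (8 * M) = 1 / (16 * M) + 1 / (16 * M) := by field_simp; norm_num
        linarith
      exact le_trans (b := (nearCount d (r + 1 / (16 * M)) θ : ℝ)) hθ
        (Nat.cast_le.2 (nearCount_mono d h3 θ))
    refine h1.trans ((mul_le_mul_of_nonneg_left h2 (by positivity)).trans_eq ?_)
    have e1 : (n : ℝ) / s = 9 / δ := by rw [hs]; field_simp
    rw [e1, hr]
    field_simp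
  set t : ℝ := (n : ℝ)⁻¹ ^ 3 with ht
  have ht0 : 0 < t := by positivity
  have hta : t ≤ 2 * a * L := by
    have h1 := one_div_le_two_mul_sqrt hn
    calc t = 1 / (n : ℝ) ^ 2 * (1 / n) := by rw [ht]; field_simp
      _ ≤ a * (2 * L) := by gcongr
      _ = 2 * a * L := by ring
  have hthr : freq E + t ≤ C * a * L := by
    rw [hC]; linarith
  refine le_trans (Nat.cast_le.2 (Finset.card_le_card (badDirections_anti _ _ hthr))) ?_
  -- The moment `m + 1` is large enough for the improved two-point inequality to hold at every
  -- nondegenerate coordinate.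
  set m : ℕ := ⌈K / r ^ 2⌉₊ with hm
  have hm0 : m ≠ 0 := (Nat.ceil_pos.2 (by positivity)).ne'
  have hmK : K ≤ (m + 1) * r ^ 2 := by
    have : K / r ^ 2 ≤ m := Nat.le_ceil _
    rw [div_le_iff₀ (by positivity)] at this
    nlinarith [sq_nonneg r]
  have hmle : (m : ℝ) + 1 ≤ K / r ^ 2 + 2 := by
    have := (Nat.ceil_lt_add_one (show 0 ≤ K / r ^ 2 by positivity)).le
    linarith
  have hBne : B.Nonempty := by
    rw [← Finset.card_pos]
    have : (0 : ℝ) < B.card := by rw [hBc]; positivity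
    exact_mod_cast this
  set R : ℝ := (2 : ℝ) ^ ((n : ℝ) * (1 - β + δ * (2 / 3))) with hR
  have hmom : ∀ θ ∉ E, ∑ x ∈ twoCube u v, ‖charFun B x θ‖ ^ (m + 1) ≤ R := by
    intro θ hθ
    refine (HK n m u v B r θ huv hB hBne hm0 hr0.le hmK).trans ?_
    have h1 : (nearCount d r θ : ℝ) ≤ 3 * s := (not_le.1 hθ).le
    have h2 : (2 : ℝ) ^ nearCount d r θ ≤ 2 ^ (3 * s) := by
      rw [← Real.rpow_natCast]
      exact Real.rpow_le_rpow_of_exponent_le (by norm_num) h1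
    have h3 : (1 + ε) ^ n = (2 : ℝ) ^ (δ / 3 * n) := by
      rw [hε, add_sub_cancel, Real.rpow_mul (by norm_num), Real.rpow_natCast]
    have h4 : R = 2 ^ n * 2 ^ (δ / 3 * n) * 2 ^ (3 * s) / 2 ^ (β * n) := by
      rw [← Real.rpow_natCast 2 n, ← Real.rpow_add (by norm_num), ← Real.rpow_add (by norm_num),
        ← Real.rpow_sub (by norm_num), hR, hs]
      ring_nf
    rw [h3, hBc, h4]
    gcongr
  have hmain := card_badDirections_mul_pow_le (twoCube u v) B hEm (Nat.succ_ne_zero m) ht0.le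
    (by positivity) hmom
  have htpow : (2 : ℝ) ^ (-(δ / 3 * n)) ≤ t ^ (m + 1) := by
    have e1 : t ^ (m + 1) = Real.exp (-(3 * Real.log n * (m + 1))) := by
      rw [ht, ← pow_mul, inv_pow, Real.exp_neg, ← Real.exp_log (show 0 < (n : ℝ) by positivity),
        ← Real.exp_nat_mul, Real.log_exp]
      push_cast
      ring_nf
    rw [e1, Real.rpow_def_of_pos (by norm_num), Real.exp_le_exp]
    have h1 : 3 * Real.log n * ((m : ℝ) + 1) ≤ 3 * Real.log n * (K / r ^ 2 + 2) := by gcongr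
    have h2 : 3 * Real.log n * (K / r ^ 2) = δ * Real.log 2 / 6 * n := by
      rw [hrsq, hc]
      field_simp
      norm_num
    rw [mul_add (3 * Real.log n) (K / r ^ 2), h2] at h1
    linarith
  refine le_of_mul_le_mul_right ?_ (pow_pos ht0 (m + 1))
  refine hmain.trans ?_
  calc R = (2 : ℝ) ^ ((n : ℝ) * (1 - β + δ)) * 2 ^ (-(δ / 3 * n)) := by
        rw [← Real.rpow_add (by norm_num), hR]
        ring_nf
    _ ≤ _ := by gcongr

lemma sqrt_log_div_pow {n : ℕ} (hn : 2 ≤ n) (κ : ℕ) :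
    Real.sqrt (Real.log n / (n : ℝ) ^ (2 * κ + 1)) =
      Real.sqrt (Real.log n / n) / (n : ℝ) ^ κ := by
  have hn0 : (0 : ℝ) < n := by positivity
  have : Real.log n / (n : ℝ) ^ (2 * κ + 1) = Real.log n / n / ((n : ℝ) ^ κ) ^ 2 := by
    rw [← pow_mul, pow_succ, div_div]
    ring_nf
  rw [this, Real.sqrt_div' _ (by positivity), Real.sqrt_sq (by positivity)]

end TwoCube

theorem theorem6 (β δ : ℝ) (hβ : 0 < β) (hδ : 0 < δ) :
    ∃ C : ℝ, 0 < C ∧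
      ∀ (n : ℕ), 2 ≤ n →
      ∀ (u v : Fin n → ℤ), (∀ j, u j ≠ v j) →
      ∀ (B : Finset (Fin n → ℤ)), B ⊆ TwoCube.signCube n →
        (B.card : ℝ) = (2 : ℝ) ^ (β * (n : ℝ)) →
        (((TwoCube.badDirections (TwoCube.twoCube u v) B
              (C * Real.sqrt (Real.log (n : ℝ) / (n : ℝ)))).card : ℝ)
            ≤ (2 : ℝ) ^ ((n : ℝ) * (1 - β + δ))) ∧
        (Function.Injective (fun j => u j - v j) →
          ((TwoCube.badDirections (TwoCube.twoCube u v) B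
              (C * Real.sqrt (Real.log (n : ℝ) / (n : ℝ) ^ 3))).card : ℝ)
            ≤ (2 : ℝ) ^ ((n : ℝ) * (1 - β + δ))) ∧
        ((Finset.univ.image (fun j => u j - v j)).card = n →
          TwoCube.IsWeakSidon (Finset.univ.image (fun j => u j - v j)) →
          ((TwoCube.badDirections (TwoCube.twoCube u v) B
              (C * Real.sqrt (Real.log (n : ℝ) / (n : ℝ) ^ 5))).card : ℝ)
            ≤ (2 : ℝ) ^ ((n : ℝ) * (1 - β + δ))) := by
  obtain ⟨M, N, C, hM0, hM, hC, H⟩ := TwoCube.exists_card_badDirections_le hδ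
  have hMr : (0 : ℝ) < M := by exact_mod_cast hM0
  set A : ℝ := 1 + (M : ℝ) ^ 2 * (36 / δ) ^ 2 + 100 * (M : ℝ) ^ 2 * (36 / δ) ^ 4 with hA
  have hA0 : 0 < A := by positivity
  have hA4 : 0 ≤ (M : ℝ) ^ 2 * (36 / δ) ^ 2 := by positivity
  have hA5 : 0 ≤ 100 * (M : ℝ) ^ 2 * (36 / δ) ^ 4 := by positivity
  have hA1 : 1 + (M : ℝ) ^ 2 * (36 / δ) ^ 2 ≤ A := by rw [hA]; linarith
  have hA2 : 1 ≤ A := by linarith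
  have hA3 : 100 * (M : ℝ) ^ 2 * (36 / δ) ^ 4 ≤ A := by rw [hA]; linarith
  set C' : ℝ := C * A + 2 * (N : ℝ) ^ 3 with hC'
  refine ⟨C', by positivity, fun n hn u v huv B hB hBc => ?_⟩
  have hn' : (2 : ℝ) ≤ n := by exact_mod_cast hn
  have hn0 : (0 : ℝ) < n := by linarith
  set d : Fin n → ℤ := fun j => u j - v j with hd
  set W : Set ℝ := {θ | δ * n / 9 ≤ (TwoCube.nearCount d (1 / (8 * M)) θ : ℝ)} with hW
  have hWm : MeasurableSet W := TwoCube.measurableSet_le_nearCount _ _ _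
  have claim : ∀ κ : ℕ, κ ≤ 2 → TwoCube.freq W ≤ A / (n : ℝ) ^ κ →
      ((TwoCube.badDirections (TwoCube.twoCube u v) B
        (C' * Real.sqrt (Real.log (n : ℝ) / (n : ℝ) ^ (2 * κ + 1)))).card : ℝ)
            ≤ (2 : ℝ) ^ ((n : ℝ) * (1 - β + δ)) := by
    intro κ hκ hfreq
    rw [TwoCube.sqrt_log_div_pow hn κ]
    have hpow : (n : ℝ) ^ κ ≤ (n : ℝ) ^ 2 := pow_le_pow_right₀ (by linarith) hκ
    rcases le_or_gt N n with hN | hN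
    · have h1 := H n hN hn u v huv β B hB hBc (A / (n : ℝ) ^ κ)
        (div_le_div₀ hA0.le hA2 (by positivity) hpow) hfreq
      refine le_trans (Nat.cast_le.2 (Finset.card_le_card
        (TwoCube.badDirections_anti _ _ ?_))) h1
      calc C * (A / (n : ℝ) ^ κ) * Real.sqrt (Real.log n / n)
          = C * A * (Real.sqrt (Real.log n / n) / (n : ℝ) ^ κ) := by ring
        _ ≤ C' * (Real.sqrt (Real.log n / n) / (n : ℝ) ^ κ) := by
          gcongr
          rw [hC']
          linarith [show 0 ≤ 2 * (N : ℝ) ^ 3 by positivity]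
    -- For `n < N` the threshold exceeds `1` because of the term `2 * N ^ 3`.
    · rw [TwoCube.badDirections_eq_empty]
      · simp only [Finset.card_empty, Nat.cast_zero]
        positivity
      · have hNn : (n : ℝ) ≤ N := by exact_mod_cast hN.le
        have h1 := TwoCube.one_div_le_two_mul_sqrt hn
        calc (1 : ℝ) = 2 * (n : ℝ) ^ 3 * (1 / n / 2 / (n : ℝ) ^ 2) := by field_simp
          _ ≤ C' * (Real.sqrt (Real.log n / n) / (n : ℝ) ^ κ) := by
            gcongr
            · rw [hC']
              have : (n : ℝ) ^ 3 ≤ (N : ℝ) ^ 3 := by gcongr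
              linarith [mul_pos hC hA0]
            · linarith
  have hs0 : 0 < δ * n / 9 := by positivity
  have hMs : 4 * (n : ℝ) ≤ M * (δ * n / 9) := by
    rw [div_le_iff₀ hδ] at hM
    nlinarith
  have h8 : 8 * (M : ℝ) * (1 / (8 * M)) ≤ 1 := by
    rw [mul_one_div_cancel (by positivity)]
  have e1 : δ * (n : ℝ) / 9 / 4 = n / (36 / δ) := by field_simp; norm_num
  refine ⟨?_, fun hinj => ?_, fun hcard hsidon => ?_⟩
  · have := claim 0 (by norm_num) (by
      rw [pow_zero, div_one]
      exact (TwoCube.freq_le_one hWm).trans hA2)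
    simpa using this
  · refine claim 1 (by norm_num) ?_
    have h1 := TwoCube.freq_le_nearCount_le_of_moment (h := 2) d hs0 hMs hM0 h8
      fun k hk => TwoCube.integral_norm_sum_e_sq_le_of_injective hinj hk
    refine h1.trans ?_
    have e2 : (M : ℝ) ^ 2 * (n / (δ * n / 9 / 4) ^ 2) =
        (M : ℝ) ^ 2 * (36 / δ) ^ 2 / (n : ℝ) ^ 1 := by
      rw [e1]; field_simp
    rw [e2]
    gcongr
    linarith
  · refine claim 2 le_rfl ?_
    have hinj : Function.Injective d := by
      rw [← Set.injOn_univ, ← Finset.coe_univ, ← Finset.card_image_iff, hcard]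
      simp
    have h1 := TwoCube.freq_le_nearCount_le_of_moment (h := 4) d hs0 hMs hM0 h8
      fun k hk => TwoCube.integral_norm_sum_e_pow_four_le hinj hsidon hk
    refine h1.trans ?_
    have e2 : (M : ℝ) ^ 2 * (100 * (n : ℝ) ^ 2 / (δ * n / 9 / 4) ^ 4) =
        100 * (M : ℝ) ^ 2 * (36 / δ) ^ 4 / (n : ℝ) ^ 2 := by
      rw [e1]; field_simp
    rw [e2]
    gcongr
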